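/- Let $X$ be a finite set of unit vectors in $\mathbb{C}^d$ spanning pairwise distinct lines. Its degree set is $A=\{|x^*y|^2 : x\ne y\in X\}$, and $X$ is an $s$-distance set if $|A|=s$. Call $X$ a $t$-design if every polynomial $f(z,\bar z)$ that is homogeneous of degree $t$ in $z_1,\dots,z_d$ and homogeneous of degree $t$ in $\bar z_1,\dots,\bar z_d$ has the same average over $X$ as over the unit sphere of $\mathbb{C}^d$ (with respect to the unitarily invariant probability measure). Write $A=\{\alpha_1,\dots,\alpha_s\}$ and $\alpha_0=1$, and let $A_0,\dots,A_s$ be the $0$-$1$ matrices with rows and columns indexed by $X$ such that $(A_i)_{a,b}=1$ if and only if $|a^*b|^2=\alpha_i$. **Theorem.** Let $s\ge 1$. If $X$ is an $s$-distance set and a $2(s-1)$-design, then $\{A_0,\dots,A_s\}$ is a symmetric association scheme: the $A_i$ are nonzero symmetric $0$-$1$ matrices with pairwise zero Schur product, $A_0=I$, $\sum_i A_i=J$ (the all-ones matrix), and every product $A_iA_j$ lies in the linear span of $A_0,\dots,A_s$. Moreover the scheme is $Q$-polynomial: its primitive idempotents can be ordered as $E_0=\frac{1}{|X|}J,E_1,\dots,E_s$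 such that for each $j$ there is a real polynomial $q_j$ of degree exactly $j$ with $(E_j)_{a,b}=q_j((E_1)_{a,b})$ for all $a,b\in X$. In particular, this applies to the following examples. 1. Any set of equiangular lines, that is, any $1$-distance set $X$; such a set is finite and a $0$-design. 2. The set $X$ of all vectors of $d+1$ mutually unbiased bases of $\mathbb{C}^d$, $d\ge 2$, that is, of $d+1$ orthonormal bases such that $|u^*v|^2$ is the same constant for all $u,v$ from different bases; such an $X$ is a $2$-distance set and a $2$-design. In both cases $\{A_0,\dots,A_s\}$ (with $s=1$ and $s=2$ respectively) is therefore a $Q$-polynomial association scheme. -/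

import Mathlib

open MeasureTheory

noncomputable section

/-! ### Complex lines: degree sets, distance sets, designs -/

/-- The angle between two vectors of `ℂ^d` is `|x* y|²`. -/
def angle {d : ℕ} (x y : EuclideanSpace ℂ (Fin d)) : ℝ :=
  ‖inner ℂ x y‖ ^ 2

/-- The degree set of `X`: all angles between distinct elements of `X`. -/
def degreeSet {d : ℕ} (X : Set (EuclideanSpace ℂ (Fin d))) : Set ℝ :=
  {α | ∃ x ∈ X, ∃ y ∈ X, x ≠ y ∧ angle x y = α}

/-- `X` is an `s`-distance set: a set of unit vectors which span pairwise different lines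
(two distinct unit vectors span the same line exactly when their angle is `1`)
and between which exactly `s` angles occur. -/
structure IsDistanceSet {d : ℕ} (X : Set (EuclideanSpace ℂ (Fin d))) (s : ℕ) : Prop where
  unit : ∀ x ∈ X, ‖x‖ = 1
  lines : 1 ∉ degreeSet X
  card : (degreeSet X).encard = s

/-- A polynomial in the variables `z_i` (`Sum.inl i`) and `z̄_i` (`Sum.inr i`) that is homogeneous
of degree `k` in the `z_i` and homogeneous of degree `l` in the `z̄_i`, i.e. an element of
`Hom(k, l)`. -/
def IsBihomogeneous {d : ℕ} (f : MvPolynomial (Fin d ⊕ Fin d) ℂ) (k l : ℕ) : Prop :=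
  ∀ m ∈ f.support, ∑ i, m (Sum.inl i) = k ∧ ∑ i, m (Sum.inr i) = l

/-- The value `f(z_1, …, z_d; z̄_1, …, z̄_d)`. -/
def evalConj {d : ℕ} (f : MvPolynomial (Fin d ⊕ Fin d) ℂ) (z : EuclideanSpace ℂ (Fin d)) : ℂ :=
  MvPolynomial.eval (Sum.elim (fun i => z i) (fun i => star (z i))) f

/-- The unitarily invariant probability measure on the unit sphere of `ℂ^d`: normalised surface
measure. -/
def sphereMeasure (d : ℕ) : Measure (Metric.sphere (0 : EuclideanSpace ℂ (Fin d)) 1) :=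
  ((volume : Measure (EuclideanSpace ℂ (Fin d))).toSphere Set.univ)⁻¹ •
    (volume : Measure (EuclideanSpace ℂ (Fin d))).toSphere

/-- A finite set `X` of unit vectors in `ℂ^d` is a `t`-design if every `f ∈ Hom(t, t)` has the same
average over `X` as over the unit sphere. -/
structure IsDesign {d : ℕ} (X : Finset (EuclideanSpace ℂ (Fin d))) (t : ℕ) : Prop where
  unit : ∀ x ∈ X, ‖x‖ = 1
  average : ∀ f : MvPolynomial (Fin d ⊕ Fin d) ℂ, IsBihomogeneous f t t →
    (1 / (X.card : ℂ)) * ∑ z ∈ X, evalConj f z = ∫ z, evalConj f z.1 ∂(sphereMeasure d)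

/-- `α 0 = 1` and `α 1, …, α s` list the degree set of `X` without repetition. -/
structure IsAngleList {d s : ℕ} (X : Set (EuclideanSpace ℂ (Fin d))) (α : Fin (s + 1) → ℝ) :
    Prop where
  zero : α 0 = 1
  injective : Function.Injective fun i : Fin s => α i.succ
  range : Set.range (fun i : Fin s => α i.succ) = degreeSet X

open Classical in
/-- The matrices `A_i`, indexed by `X`: the `(a, b)` entry is `1` if `|a* b|² = α_i` and `0`
otherwise. -/
def angleMatrix {d s : ℕ} (X : Finset (EuclideanSpace ℂ (Fin d))) (α : Fin (s + 1) → ℝ)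
    (i : Fin (s + 1)) : Matrix X X ℂ :=
  Matrix.of fun a b => if angle a.1 b.1 = α i then 1 else 0

/-! ### Association schemes -/

open Matrix in
open Classical in
/-- `A_0, …, A_n` form a symmetric association scheme with `n` classes: nonzero Hermitian
`0`-`1` matrices which are pairwise Schur orthogonal, with `A_0 = I` and `∑ A_i = J`, and such that
every product `A_i A_j` lies in the span of the `A_k`. -/
structure IsAssociationScheme {V : Type*} [Fintype V] {n : ℕ}
    (A : Fin (n + 1) → Matrix V V ℂ) : Prop where
  zero_one : ∀ i a b, A i a b = 0 ∨ A i a b = 1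
  ne_zero : ∀ i, A i ≠ 0
  hermitian : ∀ i, (A i).IsHermitian
  schur_orthogonal : ∀ i j, i ≠ j → A i ⊙ A j = 0
  one : A 0 = 1
  sum : ∑ i, A i = Matrix.of fun _ _ => 1
  mul_mem : ∀ i j, A i * A j ∈ Submodule.span ℂ (Set.range A)

open Classical in
/-- `E_0, …, E_n` are the primitive idempotents of the algebra spanned by `A_0, …, A_n`: nonzero
orthogonal projections which are pairwise orthogonal, sum to `I` and span the same space as the
`A_i`, with `E_0 = (1 / |V|) J`. -/
structure IsIdempotentBasis {V : Type*} [Fintype V] {n : ℕ}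
    (A E : Fin (n + 1) → Matrix V V ℂ) : Prop where
  ne_zero : ∀ j, E j ≠ 0
  hermitian : ∀ j, (E j).IsHermitian
  mul_self : ∀ j, E j * E j = E j
  mul_of_ne : ∀ i j, i ≠ j → E i * E j = 0
  sum : ∑ j, E j = 1
  span : Submodule.span ℂ (Set.range E) = Submodule.span ℂ (Set.range A)
  zero : E 0 = (1 / (Fintype.card V : ℂ)) • Matrix.of fun _ _ => 1

/-- The association scheme `A_0, …, A_n` is `Q`-polynomial: its primitive idempotents can be
ordered as `E_0, …, E_n` such that each `E_j` is a Schur (entrywise) polynomial of degree `j` in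
`E_1`. -/
def IsQPolynomial {V : Type*} [Fintype V] {n : ℕ} (A : Fin (n + 1) → Matrix V V ℂ) : Prop :=
  ∃ E : Fin (n + 1) → Matrix V V ℂ, IsIdempotentBasis A E ∧
    ∀ j : Fin (n + 1), ∃ q : Polynomial ℝ, q.degree = ((j : ℕ) : WithBot ℕ) ∧
      ∀ a b, E j a b = Polynomial.aeval (E 1 a b) q

/-- For every listing of the degree set of `X`, the Schur idempotents `A_0, …, A_s` of `X` form a
`Q`-polynomial association scheme. -/
def AnglesFormQPolynomialScheme {d : ℕ} (X : Finset (EuclideanSpace ℂ (Fin d))) (s : ℕ) : Prop :=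
  ∀ α : Fin (s + 1) → ℝ, IsAngleList (X : Set (EuclideanSpace ℂ (Fin d))) α →
    IsAssociationScheme (angleMatrix X α) ∧ IsQPolynomial (angleMatrix X α)

/-! ### Mutually unbiased bases -/

/-- A family of orthonormal bases of `ℂ^d` is mutually unbiased if the angle between vectors of
different bases is a constant. -/
def IsMutuallyUnbiased {d m : ℕ}
    (B : Fin m → OrthonormalBasis (Fin d) ℂ (EuclideanSpace ℂ (Fin d))) : Prop :=
  ∃ α : ℝ, ∀ i j, i ≠ j → ∀ k l, angle (B i k) (B j l) = α

open Classical in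
/-- All vectors of all bases of the family. -/
def basesUnion {d m : ℕ} (B : Fin m → OrthonormalBasis (Fin d) ℂ (EuclideanSpace ℂ (Fin d))) :
    Finset (EuclideanSpace ℂ (Fin d)) :=
  Finset.univ.image fun p : Fin m × Fin d => B p.1 p.2

end

/-! Let `P k` be the space of matrices `p(|a* b|²)` with `p` a real polynomial of degree below `k`.
The integral of `|x* z|^(2i) |y* z|^(2j)` over the sphere is a polynomial of degree at most `j` in
`|x* y|²` (`exists_integral_angle_pow_mul`). A `2(s-1)`-design may replace this integral by the
average over `X` as soon as `i, j ≤ s - 1`, so `P s` is closed under matrix multiplication and each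
`P k` with `k ≤ s` is an ideal of it (`IsDesign.mulClosed`).

The rest is algebra (`scheme_of_mulClosed`). A Gram-Schmidt step gives each `P k` a unit matrix, and
differences of consecutive units are orthogonal idempotents, the `k`-th a polynomial of degree
exactly `k` in the kernel. The design does not control the step from `P s` to `P (s + 1)`, but none
is needed: interpolation at the `s + 1` angles puts the identity and all `A_i` in `P (s + 1)`, so
the last idempotent is the identity minus the unit of `P s`. The idempotents span the same space as
the `A_i`, which is therefore closed under products. Since `E_1` is affine in the kernel, every
`E_j` is a polynomial of degree `j` in `E_1`.

For equiangular lines, compactness gives finiteness and the `0`-design condition only tests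
constants. For mutually unbiased bases, the frame potential equals the corresponding moment of the
sphere, which forces the design property (`isDesign_of_framePotential`). -/

open Matrix Polynomial in
/-- The matrix obtained by applying a real polynomial entrywise to a real kernel. -/
noncomputable def schurEval {V : Type*} (T : V → V → ℝ) : ℝ[X] →ₗ[ℝ] Matrix V V ℂ where
  toFun p := Matrix.of fun a b => ((p.eval (T a b) : ℝ) : ℂ)
  map_add' p q := by ext; simp
  map_smul' c p := by ext; simp

/-! ### Entrywise polynomials in a symmetric kernel: units, idempotents and the scheme. -/

namespace schurEval

open Polynomial

variable {V : Type*} {T : V → V → ℝ}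

@[simp]
lemma apply (p : ℝ[X]) (a b : V) : schurEval T p a b = ((p.eval (T a b) : ℝ) : ℂ) := rfl

lemma isHermitian (hT : ∀ a b, T a b = T b a) (p : ℝ[X]) : (schurEval T p).IsHermitian := by
  ext a b
  simp [Matrix.conjTranspose_apply, hT a b]

lemma transpose (hT : ∀ a b, T a b = T b a) (p : ℝ[X]) :
    (schurEval T p).transpose = schurEval T p := by
  ext a b
  simp [hT a b]

/-- A polynomial of degree at most `s` is determined by its values at `s + 1` attained points. -/
lemma eq_zero_of_degree_lt {s : ℕ} {α : Fin (s + 1) → ℝ} (hα : Function.Injective α)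
    (hatt : ∀ i, ∃ a b, T a b = α i) {p : ℝ[X]} (hp : p.degree < ((s + 1 : ℕ) : WithBot ℕ))
    (h : schurEval T p = 0) : p = 0 := by
  refine Polynomial.eq_zero_of_degree_lt_of_eval_index_eq_zero Finset.univ
    (v := α) hα.injOn (by simpa using hp) fun i _ => ?_
  obtain ⟨a, b, hab⟩ := hatt i
  have := congrFun (congrFun h a) b
  rw [apply, hab] at this
  simpa using this

/-- Symmetric matrices with a symmetric product commute: transpose the equation. With `r = 0` this
turns one-sided orthogonality into two-sided. -/
lemma mul_comm_of_mul_eq [Fintype V] (hT : ∀ a b, T a b = T b a) {p q r : ℝ[X]}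
    (h : schurEval T p * schurEval T q = schurEval T r) :
    schurEval T q * schurEval T p = schurEval T r := by
  rw [← transpose hT r, ← h, Matrix.transpose_mul, transpose hT, transpose hT]

/-- Polynomials of degree below `k + 1` split off their leading term along any polynomial of degree
`k`. -/
lemma _root_.Polynomial.exists_eq_smul_add_degree_lt {k : ℕ} {g : ℝ[X]}
    (hg : g.degree = (k : WithBot ℕ)) {p : ℝ[X]} (hp : p.degree < ((k + 1 : ℕ) : WithBot ℕ)) :
    ∃ (c : ℝ) (p' : ℝ[X]), p'.degree < (k : WithBot ℕ) ∧ p = c • g + p' := by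
  have hgk : g.natDegree = k := natDegree_eq_of_degree_eq_some hg
  have hlc : g.coeff k ≠ 0 := by
    rw [← hgk]
    exact leadingCoeff_ne_zero.2 (by rintro rfl; simp at hg)
  refine ⟨p.coeff k / g.coeff k, p - (p.coeff k / g.coeff k) • g, ?_, by ring⟩
  rw [Polynomial.degree_lt_iff_coeff_zero] at hp ⊢
  intro m hm
  rcases hm.eq_or_lt with rfl | hm
  · simp [hlc]
  · have : g.coeff m = 0 := coeff_eq_zero_of_natDegree_lt (by omega)
    simp [hp m hm, this]

/-- The kernel algebra is graded: products of matrices attached to polynomials of degree below `s`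
come from polynomials whose degree does not exceed that of the right factor. -/
def MulClosed [Fintype V] (T : V → V → ℝ) (s : ℕ) : Prop :=
  ∀ p q : ℝ[X], p.degree < (s : WithBot ℕ) → ∀ k : ℕ, k ≤ s → q.degree < (k : WithBot ℕ) →
    ∃ r : ℝ[X], r.degree < (k : WithBot ℕ) ∧ schurEval T p * schurEval T q = schurEval T r

/-- `u` has degree below `k` and its matrix is the identity of the algebra of all matrices attached
to polynomials of degree below `k`. -/
structure IsUnitBelow [Fintype V] (T : V → V → ℝ) (k : ℕ) (u : ℝ[X]) : Prop where
  degree_lt : u.degree < (k : WithBot ℕ)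
  mul : ∀ p : ℝ[X], p.degree < (k : WithBot ℕ) → schurEval T p * schurEval T u = schurEval T p

lemma IsUnitBelow.mul_left [Fintype V] (hT : ∀ a b, T a b = T b a) {k : ℕ} {u : ℝ[X]}
    (hu : IsUnitBelow T k u) {p : ℝ[X]} (hp : p.degree < (k : WithBot ℕ)) :
    schurEval T u * schurEval T p = schurEval T p :=
  mul_comm_of_mul_eq hT (hu.mul p hp)

/-- One Gram-Schmidt step: the part of `X ^ k` annihilated by lower degrees is a nonzero multiple of
an idempotent, and adding that idempotent to the old unit gives the new one. -/
lemma exists_isUnitBelow_succ [Fintype V] (hT : ∀ a b, T a b = T b a) {s : ℕ}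
    {α : Fin (s + 1) → ℝ} (hα : Function.Injective α) (hatt : ∀ i, ∃ a b, T a b = α i)
    (hmul : MulClosed T s) {k : ℕ} (hk : k < s) {u : ℝ[X]} (hu : IsUnitBelow T k u) :
    ∃ v, IsUnitBelow T (k + 1) v := by
  have hX : (X ^ k : ℝ[X]).degree < (s : WithBot ℕ) := by
    rw [degree_X_pow]; exact_mod_cast hk
  obtain ⟨r, hr, hXu⟩ := hmul _ u hX k hk.le hu.degree_lt
  -- Multiplication by the matrix of `u` projects onto degrees below `k`, so `N` is `X ^ k` minus
  -- its projection.
  set N : ℝ[X] := X ^ k - r with hN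
  have hNdeg : N.degree = (k : WithBot ℕ) := by
    rw [hN, degree_sub_eq_left_of_degree_lt (by rwa [degree_X_pow]), degree_X_pow]
  have hNs : N.degree < (s : WithBot ℕ) := by rw [hNdeg]; exact_mod_cast hk
  have hNk : N.degree < ((k + 1 : ℕ) : WithBot ℕ) := by
    rw [hNdeg]; exact_mod_cast k.lt_succ_self
  have hNp : ∀ p : ℝ[X], p.degree < (k : WithBot ℕ) → schurEval T N * schurEval T p = 0 := by
    intro p hp
    rw [hN, map_sub, sub_mul, ← hXu, mul_assoc, hu.mul_left hT hp, sub_self]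
  have hpN : ∀ p : ℝ[X], p.degree < (k : WithBot ℕ) → schurEval T p * schurEval T N = 0 := by
    intro p hp
    simpa using mul_comm_of_mul_eq hT (r := 0) (by simpa using hNp p hp)
  obtain ⟨r₂, hr₂, hNN⟩ := hmul N N hNs (k + 1) hk hNk
  obtain ⟨a, r', hr', rfl⟩ := exists_eq_smul_add_degree_lt hNdeg hr₂
  -- The unit fixes the matrix of `r'` because its degree is below `k`, but kills it because that
  -- matrix is a combination of `N * N` and `N`.
  have hr0 : schurEval T r' = 0 := by
    have : schurEval T r' = schurEval T N * schurEval T N - a • schurEval T N := by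
      rw [hNN]; simp
    rw [← hu.mul r' hr', this, sub_mul, mul_assoc, hNp u hu.degree_lt, smul_mul_assoc,
      hNp u hu.degree_lt]
    simp
  have hNN' : schurEval T N * schurEval T N = a • schurEval T N := by
    rw [hNN]; simp [hr0]
  have hN0 : schurEval T N ≠ 0 := by
    intro h
    have h0 := eq_zero_of_degree_lt hα hatt
      (hNs.trans (by exact_mod_cast s.lt_succ_self)) h
    rw [h0] at hNdeg
    simp at hNdeg
  -- A nonzero Hermitian matrix has nonzero square.
  have ha : a ≠ 0 := by
    rintro rfl
    apply hN0
    open scoped ComplexOrder in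
    rw [← Matrix.conjTranspose_mul_self_eq_zero, (isHermitian hT N).eq, hNN', zero_smul]
  refine ⟨u + a⁻¹ • N, ?_, ?_⟩
  · refine (degree_add_le _ _).trans_lt (max_lt ?_ ?_)
    · exact hu.degree_lt.trans (by exact_mod_cast k.lt_succ_self)
    · exact (degree_smul_le _ _).trans_lt hNk
  · intro p hp
    obtain ⟨c, p', hp', rfl⟩ := exists_eq_smul_add_degree_lt hNdeg hp
    simp only [map_add, map_smul, add_mul, mul_add, smul_mul_assoc, mul_smul_comm, hNN',
      hNp u hu.degree_lt, hpN p' hp', hu.mul p' hp', smul_zero, zero_add, add_zero,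
      smul_comm a⁻¹ c, inv_smul_smul₀ ha]
    rw [add_comm]

/-- The induction stops at `s`, since `MulClosed` only allows left factors of degree below `s`. -/
lemma exists_isUnitBelow [Fintype V] (hT : ∀ a b, T a b = T b a) {s : ℕ}
    {α : Fin (s + 1) → ℝ} (hα : Function.Injective α) (hatt : ∀ i, ∃ a b, T a b = α i)
    (hmul : MulClosed T s) : ∀ k ≤ s, ∃ u, IsUnitBelow T k u
  | 0, _ => ⟨0, by simp, fun p hp => by
      have : p = 0 := by simpa using hp
      simp [this]⟩
  | k + 1, hk => by
    obtain ⟨u, hu⟩ := exists_isUnitBelow hT hα hatt hmul k (by omega)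
    exact exists_isUnitBelow_succ hT hα hatt hmul (by omega) hu

open Classical in
/-- If the kernel takes the values `α 0, …, α s`, with `α 0` exactly on the diagonal, then the
identity matrix comes from the Lagrange polynomial at `α 0`. -/
lemma exists_isUnitBelow_top [Fintype V] {s : ℕ}
    {α : Fin (s + 1) → ℝ} (hα : Function.Injective α)
    (hval : ∀ a b, ∃ i, T a b = α i) (hdiag : ∀ a b, T a b = α 0 ↔ a = b) :
    ∃ u, IsUnitBelow T (s + 1) u ∧ u.degree = (s : WithBot ℕ) ∧ schurEval T u = 1 := by
  set u := Lagrange.basis Finset.univ α 0 with hu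
  have hdeg : u.degree = (s : WithBot ℕ) := by
    rw [hu, Lagrange.degree_basis hα.injOn (Finset.mem_univ _)]; simp
  have h1 : schurEval T u = 1 := by
    ext a b
    obtain ⟨i, hi⟩ := hval a b
    rw [apply, hi, Matrix.one_apply]
    by_cases h : i = 0
    · subst h
      rw [if_pos ((hdiag a b).1 hi), hu,
        Lagrange.eval_basis_self hα.injOn (Finset.mem_univ _)]
      simp
    · rw [if_neg, hu, Lagrange.eval_basis_of_ne (Ne.symm h) (Finset.mem_univ _)]
      · simp
      · intro hab
        exact h (hα (hi.symm.trans ((hdiag a b).2 hab)))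
  refine ⟨u, ⟨?_, fun p _ => by rw [h1, mul_one]⟩, hdeg, h1⟩
  rw [hdeg]; exact_mod_cast s.lt_succ_self

/-- The units form an increasing chain of commuting idempotents. -/
lemma IsUnitBelow.mul_of_le [Fintype V] (hT : ∀ a b, T a b = T b a) {k l : ℕ} {u v : ℝ[X]}
    (hu : IsUnitBelow T k u) (hv : IsUnitBelow T l v) (hkl : k ≤ l) :
    schurEval T u * schurEval T v = schurEval T u ∧
      schurEval T v * schurEval T u = schurEval T u := by
  have h : u.degree < (l : WithBot ℕ) := hu.degree_lt.trans_le (by exact_mod_cast hkl)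
  exact ⟨hv.mul u h, hv.mul_left hT h⟩

/-- The degree of the unit of the algebra of polynomials of degree at most `k` is exactly `k`. -/
lemma IsUnitBelow.degree_eq [Fintype V] {s : ℕ} {α : Fin (s + 1) → ℝ}
    (hα : Function.Injective α) (hatt : ∀ i, ∃ a b, T a b = α i)
    (hmul : MulClosed T s) {k : ℕ} (hk : k < s) {u : ℝ[X]} (hu : IsUnitBelow T (k + 1) u) :
    u.degree = (k : WithBot ℕ) := by
  have hX : (X ^ k : ℝ[X]).degree < (s : WithBot ℕ) := by
    rw [degree_X_pow]; exact_mod_cast hk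
  refine le_antisymm ?_ ?_
  · rw [degree_le_iff_coeff_zero]
    have := (Polynomial.degree_lt_iff_coeff_zero _ _).1 hu.degree_lt
    intro m hm
    exact this m (by exact_mod_cast hm)
  · by_contra! h
    -- A unit of degree below `k` would, by the grading, give `X ^ k` the same matrix as a
    -- polynomial of degree below `k`; the `s + 1` attained values tell these apart.
    obtain ⟨r, hr, hXu⟩ := hmul _ u hX k hk.le h
    rw [hu.mul _ (by rw [degree_X_pow]; exact_mod_cast k.lt_succ_self)] at hXu
    have h0 : (X ^ k - r : ℝ[X]) = 0 := by
      refine eq_zero_of_degree_lt hα hatt ?_ (by rw [map_sub, hXu, sub_self])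
      rw [degree_sub_eq_left_of_degree_lt (by rwa [degree_X_pow]), degree_X_pow]
      exact_mod_cast hk.trans s.lt_succ_self
    rw [← sub_eq_zero.1 h0, degree_X_pow] at hr
    exact lt_irrefl _ hr

/-- Orthogonal idempotents of the algebra, the `k`-th one being a polynomial of degree `k`. -/
structure IsIdempotentSystem [Fintype V] [DecidableEq V] (T : V → V → ℝ) (s : ℕ)
    (g : ℕ → ℝ[X]) : Prop where
  degree : ∀ k ≤ s, (g k).degree = (k : WithBot ℕ)
  mul_self : ∀ k ≤ s, schurEval T (g k) * schurEval T (g k) = schurEval T (g k)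
  mul_of_ne : ∀ k ≤ s, ∀ l ≤ s, k ≠ l → schurEval T (g k) * schurEval T (g l) = 0
  sum : ∑ k ∈ Finset.range (s + 1), schurEval T (g k) = 1

-- The `k`-th idempotent is the difference of the units for degrees below `k + 1` and below `k`.
open Classical in
theorem exists_isIdempotentSystem [Fintype V] (hT : ∀ a b, T a b = T b a) {s : ℕ}
    {α : Fin (s + 1) → ℝ} (hα : Function.Injective α) (hatt : ∀ i, ∃ a b, T a b = α i)
    (hval : ∀ a b, ∃ i, T a b = α i) (hdiag : ∀ a b, T a b = α 0 ↔ a = b)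
    (hmul : MulClosed T s) : ∃ g, IsIdempotentSystem T s g := by
  choose! u hu using exists_isUnitBelow hT hα hatt hmul
  obtain ⟨v, hv, hvdeg, hv1⟩ := exists_isUnitBelow_top hα hval hdiag
  -- The chain of units is completed at index `s + 1` by the interpolation polynomial `v` of the
  -- identity matrix.
  set w : ℕ → ℝ[X] := fun k => if k ≤ s then u k else v with hw
  have hwu : ∀ k ≤ s + 1, IsUnitBelow T k (w k) := by
    intro k hk
    by_cases h : k ≤ s
    · simpa [hw, h] using hu k h
    · obtain rfl : k = s + 1 := by omega
      simpa [hw] using hv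
  have hwdeg : ∀ k ≤ s, (w (k + 1)).degree = (k : WithBot ℕ) := by
    intro k hk
    rcases hk.eq_or_lt with rfl | hk
    · simpa [hw] using hvdeg
    · exact (hwu (k + 1) (by omega)).degree_eq hα hatt hmul hk
  -- Degree below `0` means zero, so the idempotents telescope to the last unit, the identity.
  have hw0 : w 0 = 0 := by simpa using (hwu 0 (by omega)).degree_lt
  have key : ∀ k l, k ≤ l → l ≤ s + 1 →
      schurEval T (w k) * schurEval T (w l) = schurEval T (w k) ∧
      schurEval T (w l) * schurEval T (w k) = schurEval T (w k) := fun k l hkl hl =>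
    (hwu k (by omega)).mul_of_le hT (hwu l hl) hkl
  have orth : ∀ k l, k < l → l ≤ s →
      (schurEval T (w (k + 1)) - schurEval T (w k)) *
        (schurEval T (w (l + 1)) - schurEval T (w l)) = 0 := by
    intro k l hkl hl
    simp only [sub_mul, mul_sub, (key (k + 1) (l + 1) (by omega) (by omega)).1,
      (key (k + 1) l (by omega) (by omega)).1, (key k (l + 1) (by omega) (by omega)).1,
      (key k l (by omega) (by omega)).1, sub_self]
  refine ⟨fun k => w (k + 1) - w k, ?_, ?_, ?_, ?_⟩
  · intro k hk
    rw [degree_sub_eq_left_of_degree_lt, hwdeg k hk]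
    rw [hwdeg k hk]
    exact (hwu k (by omega)).degree_lt
  · intro k hk
    simp only [map_sub, sub_mul, mul_sub, (key (k + 1) (k + 1) le_rfl (by omega)).1,
      (key k (k + 1) (by omega) (by omega)).1, (key k (k + 1) (by omega) (by omega)).2,
      (key k k le_rfl (by omega)).1, sub_self, sub_zero]
  · intro k hk l hl hkl
    rcases hkl.lt_or_gt with h | h
    · simpa using orth k l h hl
    · have := mul_comm_of_mul_eq hT (r := 0) (p := w (l + 1) - w l) (q := w (k + 1) - w k)
        (by simpa using orth l k h hk)
      simpa using this
  · simp only [map_sub]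
    rw [Finset.sum_range_sub (fun k => schurEval T (w k)), hw0]
    simp [hw, hv1]

/-- The matrices attached to polynomials of degree below `k` are spanned by the first `k`
idempotents. -/
lemma mem_span_of_degree_lt [Fintype V] [DecidableEq V] {s : ℕ} {g : ℕ → ℝ[X]}
    (hg : IsIdempotentSystem T s g) : ∀ k ≤ s + 1, ∀ p : ℝ[X], p.degree < (k : WithBot ℕ) →
      schurEval T p ∈ Submodule.span ℂ
        (Set.range fun j : Fin (s + 1) => schurEval T (g j))
  | 0, _, p, hp => by
    have : p = 0 := by simpa using hp
    simp [this]
  | k + 1, hk, p, hp => by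
    obtain ⟨c, p', hp', rfl⟩ := exists_eq_smul_add_degree_lt (hg.degree k (by omega)) hp
    rw [map_add, map_smul]
    refine Submodule.add_mem _ ?_ (mem_span_of_degree_lt hg k (by omega) p' hp')
    rw [← Complex.coe_smul]
    exact Submodule.smul_mem _ _ (Submodule.subset_span ⟨⟨k, by omega⟩, rfl⟩)

/-- A symmetric kernel with `s + 1` values whose polynomials of degree below `s` form a graded
algebra gives rise to a `Q`-polynomial association scheme. -/
theorem scheme_of_mulClosed [Fintype V] (hT : ∀ a b, T a b = T b a) {s : ℕ} (hs : 1 ≤ s)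
    {α : Fin (s + 1) → ℝ} (hα : Function.Injective α) (hatt : ∀ i, ∃ a b, T a b = α i)
    (hval : ∀ a b, ∃ i, T a b = α i) (hdiag : ∀ a b, T a b = α 0 ↔ a = b)
    (hmul : MulClosed T s) {A : Fin (s + 1) → Matrix V V ℂ}
    (hA1 : ∀ i a b, T a b = α i → A i a b = 1) (hA0 : ∀ i a b, T a b ≠ α i → A i a b = 0) :
    IsAssociationScheme A ∧ IsQPolynomial A := by
  classical
  obtain ⟨g, hg⟩ := exists_isIdempotentSystem hT hα hatt hval hdiag hmul
  -- Exactly one `A j` is nonzero at each entry.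
  have hsum : ∀ (c : Fin (s + 1) → ℂ) a b i, T a b = α i → ∑ j, c j * A j a b = c i := by
    intro c a b i hi
    rw [Finset.sum_eq_single i]
    · rw [hA1 i a b hi, mul_one]
    · intro j _ hj
      rw [hA0 j a b, mul_zero]
      exact fun h => hj (hα (h.symm.trans hi))
    · simp
  have hΦA : ∀ p, schurEval T p ∈ Submodule.span ℂ (Set.range A) := by
    intro p
    have : schurEval T p = ∑ i, ((p.eval (α i) : ℝ) : ℂ) • A i := by
      ext a b
      obtain ⟨i, hi⟩ := hval a b
      simp only [Matrix.sum_apply, Matrix.smul_apply, smul_eq_mul]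
      rw [hsum _ a b i hi, apply, hi]
    rw [this]
    exact Submodule.sum_mem _ fun i _ => Submodule.smul_mem _ _ (Submodule.subset_span ⟨i, rfl⟩)
  have hAΦ : ∀ i, A i = schurEval T (Lagrange.basis Finset.univ α i) := by
    intro i
    ext a b
    obtain ⟨j, hj⟩ := hval a b
    rw [apply, hj]
    by_cases h : j = i
    · subst h
      rw [hA1 j a b hj, Lagrange.eval_basis_self hα.injOn (Finset.mem_univ _)]; simp
    · rw [hA0 i a b, Lagrange.eval_basis_of_ne (Ne.symm h) (Finset.mem_univ _)]
      · simp
      · exact fun h' => h (hα (hj.symm.trans h'))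
  have hspan : Submodule.span ℂ (Set.range fun j : Fin (s + 1) => schurEval T (g j)) =
      Submodule.span ℂ (Set.range A) := by
    refine le_antisymm (Submodule.span_le.2 ?_) (Submodule.span_le.2 ?_)
    · rintro _ ⟨j, rfl⟩
      exact hΦA _
    · rintro _ ⟨i, rfl⟩
      rw [hAΦ i]
      refine mem_span_of_degree_lt hg (s + 1) le_rfl _ ?_
      rw [Lagrange.degree_basis hα.injOn (Finset.mem_univ _)]
      simp only [Finset.card_univ, Fintype.card_fin, Nat.add_sub_cancel]
      exact_mod_cast s.lt_succ_self
  have hEne : ∀ j : Fin (s + 1), schurEval T (g j) ≠ 0 := by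
    intro j h
    have hd := hg.degree j (by omega)
    have h0 := eq_zero_of_degree_lt hα hatt (by rw [hd]; exact_mod_cast j.2) h
    rw [h0] at hd
    simp at hd
  obtain ⟨a₀, b₀, -⟩ := hatt 0
  refine ⟨⟨?_, ?_, ?_, ?_, ?_, ?_, ?_⟩, fun j => schurEval T (g j),
    ⟨hEne, fun j => isHermitian hT _, fun j => hg.mul_self j (by omega), ?_, ?_, hspan, ?_⟩, ?_⟩
  · intro i a b
    by_cases h : T a b = α i
    · exact Or.inr (hA1 i a b h)
    · exact Or.inl (hA0 i a b h)
  · intro i h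
    obtain ⟨a, b, hab⟩ := hatt i
    have := hA1 i a b hab
    simp [h] at this
  · intro i
    rw [hAΦ i]
    exact isHermitian hT _
  · intro i j hij
    ext a b
    by_cases h : T a b = α i
    · simp [hA0 j a b fun h' => hij (hα (h.symm.trans h'))]
    · simp [hA0 i a b h]
  · ext a b
    rw [Matrix.one_apply]
    split_ifs with h
    · exact hA1 0 a b ((hdiag a b).2 h)
    · exact hA0 0 a b fun h' => h ((hdiag a b).1 h')
  · ext a b
    obtain ⟨i, hi⟩ := hval a b
    simpa [Matrix.sum_apply] using hsum (fun _ => 1) a b i hi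
  · intro i j
    rw [← hspan]
    have hmem : ∀ i, A i ∈ Submodule.span ℂ
        (Set.range fun j : Fin (s + 1) => schurEval T (g j)) := fun i => by
      rw [hspan]; exact Submodule.subset_span ⟨i, rfl⟩
    have hsq := Submodule.mul_mem_mul (hmem i) (hmem j)
    rw [Submodule.span_mul_span] at hsq
    -- Closure under products is checked on the idempotents, where a product is either zero or a
    -- single idempotent.
    refine Submodule.span_le.2 ?_ hsq
    rintro _ ⟨_, ⟨k, rfl⟩, _, ⟨l, rfl⟩, rfl⟩
    by_cases hkl : k = l
    · subst hkl
      simp only [hg.mul_self k (by omega)]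
      exact Submodule.subset_span ⟨k, rfl⟩
    · simp [hg.mul_of_ne k (by omega) l (by omega) (fun h => hkl (Fin.ext h))]
  · intro i j hij
    exact hg.mul_of_ne i (by omega) j (by omega) fun h => hij (Fin.ext h)
  · rw [← hg.sum, Finset.sum_range]
  · have hd := hg.degree 0 (by omega)
    have hc : g 0 = C ((g 0).coeff 0) := eq_C_of_degree_le_zero hd.le
    set c := (g 0).coeff 0
    have hc0 : c ≠ 0 := by
      intro h
      rw [hc, h] at hd
      simp at hd
    -- `E_0` has all entries equal to `c`, so idempotency reads `|V| c² = c`, whence `c = 1 / |V|`.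
    have hsq := congrFun (congrFun (hg.mul_self 0 (by omega)) a₀) b₀
    rw [hc] at hsq
    simp only [Matrix.mul_apply, apply, eval_C, Finset.sum_const, Finset.card_univ,
      nsmul_eq_mul] at hsq
    have hcC : (c : ℂ) ≠ 0 := by exact_mod_cast hc0
    have hn : (Fintype.card V : ℂ) * c = 1 := by
      apply mul_right_cancel₀ hcC
      rw [one_mul, mul_assoc, hsq]
    ext a b
    simp only [Fin.coe_ofNat_eq_mod, Nat.zero_mod, apply, Matrix.smul_apply, Matrix.of_apply,
      smul_eq_mul, mul_one]
    rw [hc, eval_C]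
    exact eq_one_div_of_mul_eq_one_right hn
  · intro j
    have hd := hg.degree 1 hs
    have hn1 : (g 1).natDegree = 1 := natDegree_eq_of_degree_eq_some hd
    have ha : (g 1).coeff 1 ≠ 0 := by
      have := leadingCoeff_ne_zero.2 (show g 1 ≠ 0 from fun h => by simp [h] at hd)
      rwa [leadingCoeff, hn1] at this
    set a := (g 1).coeff 1
    set b := (g 1).coeff 0
    have hg1 : g 1 = C a * X + C b := eq_X_add_C_of_natDegree_le_one hn1.le
    -- The inverse of the affine map `g 1` recovers the kernel from `E_1`.
    set l : ℝ[X] := C a⁻¹ * (X - C b) with hl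
    have hld : l.natDegree = 1 := by
      rw [hl, natDegree_C_mul (inv_ne_zero ha), natDegree_X_sub_C]
    -- For `s = 0` the numeral would wrap around to `0`.
    have h1 : ((1 : Fin (s + 1)) : ℕ) = 1 := by
      rw [Fin.val_one', Nat.mod_eq_of_lt (by omega)]
    have hdj := hg.degree j (by omega)
    refine ⟨(g j).comp l, ?_, ?_⟩
    · have hnz : (g j).comp l ≠ 0 := by
        intro h
        rcases comp_eq_zero_iff.1 h with h | ⟨-, h⟩
        · rw [h] at hdj; simp at hdj
        · rw [h] at hld; simp at hld
      rw [degree_eq_natDegree hnz, natDegree_comp, hld, mul_one,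
        natDegree_eq_of_degree_eq_some hdj]
    · intro x y
      have : (schurEval T (g ((1 : Fin (s + 1)) : ℕ)) x y) = algebraMap ℝ ℂ ((g 1).eval (T x y)) := by
        rw [h1]; rfl
      beta_reduce
      rw [this, aeval_algebraMap_apply, apply]
      simp only [coe_aeval_eq_eval, eval_comp, Complex.coe_algebraMap]
      congr 2
      rw [hl, hg1]
      simp [ha]

end schurEval

/-! ### Unitary invariance of the sphere measure and convolution of zonal functions. -/

section Sphere

variable {d : ℕ}

/-- The self-map of the unit sphere induced by a linear isometry. -/
noncomputable def sphereMap (U : EuclideanSpace ℂ (Fin d) ≃ₗᵢ[ℂ] EuclideanSpace ℂ (Fin d))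
    (z : Metric.sphere (0 : EuclideanSpace ℂ (Fin d)) 1) :
    Metric.sphere (0 : EuclideanSpace ℂ (Fin d)) 1 :=
  ⟨U z.1, by simp⟩

lemma continuous_sphereMap (U : EuclideanSpace ℂ (Fin d) ≃ₗᵢ[ℂ] EuclideanSpace ℂ (Fin d)) :
    Continuous (sphereMap U) :=
  (U.continuous.comp continuous_subtype_val).subtype_mk _

lemma measurePreserving_unitary
    (U : EuclideanSpace ℂ (Fin d) ≃ₗᵢ[ℂ] EuclideanSpace ℂ (Fin d)) :
    MeasurePreserving U (volume : Measure (EuclideanSpace ℂ (Fin d))) volume := by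
  let U' : EuclideanSpace ℂ (Fin d) ≃ₗᵢ[ℝ] EuclideanSpace ℂ (Fin d) :=
    { U.toLinearEquiv.restrictScalars ℝ with norm_map' := U.norm_map }
  exact U'.measurePreserving

-- The surface measure of a set is a fixed multiple of the volume of the cone over it, and a unitary
-- map carries cones to cones and preserves volume.
open Pointwise in
lemma toSphere_preimage_sphereMap
    (U : EuclideanSpace ℂ (Fin d) ≃ₗᵢ[ℂ] EuclideanSpace ℂ (Fin d))
    {s : Set (Metric.sphere (0 : EuclideanSpace ℂ (Fin d)) 1)} (hs : MeasurableSet s) :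
    (volume : Measure (EuclideanSpace ℂ (Fin d))).toSphere (sphereMap U ⁻¹' s) =
      (volume : Measure (EuclideanSpace ℂ (Fin d))).toSphere s := by
  rw [Measure.toSphere_apply' _ hs,
    Measure.toSphere_apply' _ ((continuous_sphereMap U).measurable hs)]
  congr 1
  have : Set.Ioo (0 : ℝ) 1 • (Subtype.val '' (sphereMap U ⁻¹' s)) =
      U ⁻¹' (Set.Ioo (0 : ℝ) 1 • (Subtype.val '' s)) := by
    ext z
    simp only [Set.mem_smul, Set.mem_image, Set.mem_preimage]
    constructor
    · rintro ⟨r, hr, _, ⟨x, hx, rfl⟩, rfl⟩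
      exact ⟨r, hr, _, ⟨_, hx, rfl⟩, (U.toLinearMap.map_smul_of_tower r x.1).symm⟩
    · rintro ⟨r, hr, _, ⟨x, hx, rfl⟩, h⟩
      refine ⟨r, hr, _, ⟨sphereMap U.symm x, ?_, rfl⟩, ?_⟩
      · convert hx
        simp [sphereMap]
      · rw [← U.symm_apply_apply z, ← h]
        exact (U.symm.toLinearMap.map_smul_of_tower r x.1).symm
  rw [this, (measurePreserving_unitary U).measure_preimage_emb
    U.toHomeomorph.measurableEmbedding]

lemma map_sphereMap (U : EuclideanSpace ℂ (Fin d) ≃ₗᵢ[ℂ] EuclideanSpace ℂ (Fin d)) :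
    (sphereMeasure d).map (sphereMap U) = sphereMeasure d := by
  ext s hs
  rw [Measure.map_apply (continuous_sphereMap U).measurable hs]
  simp only [sphereMeasure, Measure.smul_apply]
  rw [toSphere_preimage_sphereMap U hs]

lemma integral_comp_sphereMap
    (U : EuclideanSpace ℂ (Fin d) ≃ₗᵢ[ℂ] EuclideanSpace ℂ (Fin d))
    {f : Metric.sphere (0 : EuclideanSpace ℂ (Fin d)) 1 → ℂ} (hf : Continuous f) :
    ∫ z, f (sphereMap U z) ∂(sphereMeasure d) = ∫ z, f z ∂(sphereMeasure d) := by
  conv_rhs => rw [← map_sphereMap U]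
  rw [integral_map (continuous_sphereMap U).measurable.aemeasurable]
  exact hf.aestronglyMeasurable

lemma isProbabilityMeasure_sphereMeasure (hd : d ≠ 0) :
    IsProbabilityMeasure (sphereMeasure d) := by
  have : NeZero d := ⟨hd⟩
  constructor
  rw [sphereMeasure, Measure.smul_apply, smul_eq_mul]
  refine ENNReal.inv_mul_cancel ?_ (measure_ne_top _ _)
  rw [Ne, Measure.measure_univ_eq_zero]
  exact Measure.toSphere_ne_zero _

lemma integrable_of_continuous {F : Type*} [NormedAddCommGroup F] (hd : d ≠ 0)
    {f : Metric.sphere (0 : EuclideanSpace ℂ (Fin d)) 1 → F} (hf : Continuous f) :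
    Integrable f (sphereMeasure d) := by
  have := isProbabilityMeasure_sphereMeasure hd
  exact hf.integrable_of_hasCompactSupport (HasCompactSupport.of_compactSpace f)

/-- The unitary group acts transitively on orthonormal families of a given size. -/
lemma exists_unitary_map {m : ℕ} {v v' : Fin m → EuclideanSpace ℂ (Fin d)}
    (hv : Orthonormal ℂ v) (hv' : Orthonormal ℂ v') :
    ∃ U : EuclideanSpace ℂ (Fin d) ≃ₗᵢ[ℂ] EuclideanSpace ℂ (Fin d), ∀ i, U (v i) = v' i := by
  have hmd : m ≤ d := by
    simpa using hv.linearIndependent.fintype_card_le_finrank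
  have hinj : Function.Injective (Fin.castLE hmd) := Fin.castLE_injective hmd
  have key : ∀ w : Fin m → EuclideanSpace ℂ (Fin d), Orthonormal ℂ w →
      ∃ b : OrthonormalBasis (Fin d) ℂ (EuclideanSpace ℂ (Fin d)),
        ∀ i, b (Fin.castLE hmd i) = w i := by
    intro w hw
    obtain ⟨b, hb⟩ := Orthonormal.exists_orthonormalBasis_extension_of_card_eq
      (𝕜 := ℂ) (E := EuclideanSpace ℂ (Fin d)) (ι := Fin d) (by simp)
      (v := Function.extend (Fin.castLE hmd) w 0) (s := Set.range (Fin.castLE hmd)) (by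
        constructor
        · rintro ⟨_, i, rfl⟩
          simpa [Set.domRestrict, hinj.extend_apply] using hw.1 i
        · rintro ⟨_, i, rfl⟩ ⟨_, j, rfl⟩ hij
          simp only [Set.domRestrict, hinj.extend_apply]
          exact hw.2 fun h => hij (by simp [h]))
    refine ⟨b, fun i => ?_⟩
    rw [hb _ ⟨i, rfl⟩, hinj.extend_apply]
  obtain ⟨b, hb⟩ := key v hv
  obtain ⟨b', hb'⟩ := key v' hv'
  refine ⟨b.equiv b' (Equiv.refl _), fun i => ?_⟩
  rw [← hb, ← hb', OrthonormalBasis.equiv_apply_basis]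
  rfl

/-- Invariance and transitivity combined: the choice of the orthonormal family is irrelevant, so
moments can be computed on a fixed reference family. -/
lemma integral_orthonormal {m : ℕ} {v v' : Fin m → EuclideanSpace ℂ (Fin d)}
    (hv : Orthonormal ℂ v) (hv' : Orthonormal ℂ v') {G : (Fin m → ℂ) → ℂ} (hG : Continuous G) :
    ∫ z, G (fun i => inner ℂ (v i) z.1) ∂(sphereMeasure d) =
      ∫ z, G (fun i => inner ℂ (v' i) z.1) ∂(sphereMeasure d) := by
  obtain ⟨U, hU⟩ := exists_unitary_map hv hv'
  rw [← integral_comp_sphereMap U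
    (f := fun z : Metric.sphere (0 : EuclideanSpace ℂ (Fin d)) 1 =>
      G (fun i => inner ℂ (v' i) z.1)) (by fun_prop)]
  refine integral_congr_ae (Filter.Eventually.of_forall fun z => ?_)
  simp only [sphereMap, ← hU, LinearIsometryEquiv.inner_map_map]

/-- The mixed moments of two coordinates of a point of the unit sphere. -/
noncomputable def mixedMoment (x w : EuclideanSpace ℂ (Fin d)) (p q p' q' : ℕ) : ℂ :=
  ∫ z, (inner ℂ x z.1) ^ p * (inner ℂ w z.1) ^ q *
    (star (inner ℂ x z.1) ^ p' * star (inner ℂ w z.1) ^ q') ∂(sphereMeasure d)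

lemma orthonormal_pair_iff {x w : EuclideanSpace ℂ (Fin d)} :
    Orthonormal ℂ ![x, w] ↔ ‖x‖ = 1 ∧ ‖w‖ = 1 ∧ inner ℂ x w = 0 := by
  rw [orthonormal_vecCons_iff]
  simp [orthonormal_subsingleton_iff]
  tauto

lemma mixedMoment_eq {x w x' w' : EuclideanSpace ℂ (Fin d)} (h : Orthonormal ℂ ![x, w])
    (h' : Orthonormal ℂ ![x', w']) (p q p' q' : ℕ) :
    mixedMoment x w p q p' q' = mixedMoment x' w' p q p' q' :=
  integral_orthonormal h h'
    (G := fun t => t 0 ^ p * t 1 ^ q * (star (t 0) ^ p' * star (t 1) ^ q')) (by fun_prop)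

/-- Replacing `w` by `ω • w` with `‖ω‖ = 1` keeps the pair orthonormal, hence the moment, yet
multiplies it by `star ω ^ q * ω ^ q'`. -/
lemma mixedMoment_eq_zero {x w : EuclideanSpace ℂ (Fin d)} (h : Orthonormal ℂ ![x, w])
    {q q' : ℕ} (hq : q ≠ q') (p p' : ℕ) : mixedMoment x w p q p' q' = 0 := by
  -- The order exceeds both `q` and `q'`, so equal powers of `ω` would force `q = q'`.
  have hprim := Complex.isPrimitiveRoot_exp (q + q' + 1) (by omega)
  set ω : ℂ := Complex.exp (2 * Real.pi * Complex.I / (q + q' + 1 : ℕ))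
  have hnorm : ‖ω‖ = 1 := hprim.norm'_eq_one (by omega)
  have hω : ω * star ω = 1 := by
    have := RCLike.mul_conj ω
    rw [hnorm] at this
    simpa using this
  have hpair : Orthonormal ℂ ![x, ω • w] := by
    rw [orthonormal_pair_iff] at h ⊢
    refine ⟨h.1, by rw [norm_smul, hnorm, h.2.1, one_mul], by rw [inner_smul_right, h.2.2, mul_zero]⟩
  have key : mixedMoment x w p q p' q' = star ω ^ q * ω ^ q' * mixedMoment x w p q p' q' := by
    rw [mixedMoment_eq h hpair]
    conv_rhs => rw [← mixedMoment_eq h hpair]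
    rw [mixedMoment, mixedMoment, ← integral_const_mul]
    refine integral_congr_ae (Filter.Eventually.of_forall fun z => ?_)
    simp only [inner_smul_left, star_mul', mul_pow, RCLike.star_def, RingHomCompTriple.comp_apply,
      RingHom.id_apply]
    ring
  by_contra h0
  have h1 : star ω ^ q * ω ^ q' = 1 := by
    apply mul_right_cancel₀ h0
    rw [one_mul, ← key]
  have h2 : ω ^ q = ω ^ q' := by
    calc ω ^ q = ω ^ q * (star ω ^ q * ω ^ q') := by rw [h1, mul_one]
      _ = (ω * star ω) ^ q * ω ^ q' := by ring
      _ = ω ^ q' := by rw [hω, one_pow, one_mul]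
  exact hq (hprim.pow_inj (by omega) (by omega) h2)

/-- Normalise the component of `y` orthogonal to `x`; if it vanishes, `2 ≤ d` still provides a
vector orthogonal to `x`, with `b = 0`. -/
lemma exists_orthonormal_pair (hd : 2 ≤ d) {x y : EuclideanSpace ℂ (Fin d)} (hx : ‖x‖ = 1) :
    ∃ w : EuclideanSpace ℂ (Fin d), ∃ b : ℂ, Orthonormal ℂ ![x, w] ∧
      y = inner ℂ x y • x + b • w := by
  have hxx : inner ℂ x x = (1 : ℂ) := by rw [inner_self_eq_norm_sq_to_K, hx]; simp
  obtain ⟨u, hu0, hxu, b, hb⟩ : ∃ u : EuclideanSpace ℂ (Fin d), u ≠ 0 ∧ inner ℂ x u = 0 ∧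
      ∃ b : ℂ, y - inner ℂ x y • x = b • u := by
    by_cases hv : y - inner ℂ x y • x = 0
    · have hpos : 0 < Module.finrank ℂ (Submodule.span ℂ {x})ᗮ := by
        have h1 := Submodule.finrank_add_finrank_orthogonal (Submodule.span ℂ {x})
        have h2 := finrank_span_singleton (K := ℂ) (v := x) (by rintro rfl; simp at hx)
        rw [h2, finrank_euclideanSpace_fin] at h1
        omega
      have := Module.finrank_pos_iff.1 hpos
      obtain ⟨⟨u, hu⟩, hu0⟩ := exists_ne (0 : (Submodule.span ℂ {x})ᗮ)
      exact ⟨u, by simpa using hu0, Submodule.mem_orthogonal_singleton_iff_inner_right.1 hu, 0,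
        by simpa using hv⟩
    · exact ⟨_, hv, by rw [inner_sub_right, inner_smul_right, hxx]; simp, 1, (one_smul _ _).symm⟩
  have hn : (‖u‖ : ℂ) ≠ 0 := by simpa using hu0
  refine ⟨(‖u‖ : ℂ)⁻¹ • u, b * ‖u‖, ?_, ?_⟩
  · rw [orthonormal_pair_iff]
    refine ⟨hx, ?_, by rw [inner_smul_right, hxu, mul_zero]⟩
    rw [norm_smul, norm_inv, Complex.norm_real, norm_norm, inv_mul_cancel₀ (by simpa using hu0)]
  · rw [smul_smul, mul_assoc, mul_inv_cancel₀ hn, mul_one, ← hb]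
    abel

/-- Pythagoras; this is what makes the convolution depend on the angle alone. -/
lemma norm_sq_coeff {x w y : EuclideanSpace ℂ (Fin d)} (h : Orthonormal ℂ ![x, w]) (hy : ‖y‖ = 1)
    {b : ℂ} (hyb : y = inner ℂ x y • x + b • w) : b * star b = ((1 - angle x y : ℝ) : ℂ) := by
  obtain ⟨hx, hw, hxw⟩ := orthonormal_pair_iff.1 h
  have h1 : ‖y‖ ^ 2 = ‖inner ℂ x y • x‖ ^ 2 + ‖b • w‖ ^ 2 := by
    rw [sq, sq, sq]
    conv_lhs => rw [hyb]
    refine norm_add_sq_eq_norm_sq_add_norm_sq_of_inner_eq_zero (𝕜 := ℂ) _ _ ?_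
    rw [inner_smul_left, inner_smul_right, hxw]
    simp
  rw [hy, norm_smul, norm_smul, hx, hw] at h1
  have h2 := RCLike.mul_conj b
  rw [RCLike.star_def, h2, angle]
  have : ‖b‖ ^ 2 = 1 - ‖inner ℂ x y‖ ^ 2 := by linarith
  rw [← this]
  push_cast
  rfl

lemma angle_eq_mul_star (x y : EuclideanSpace ℂ (Fin d)) :
    ((angle x y : ℝ) : ℂ) = inner ℂ x y * star (inner ℂ x y) := by
  have h2 := RCLike.mul_conj (inner ℂ x y : ℂ)
  rw [RCLike.star_def, h2, angle]
  push_cast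
  rfl

lemma angle_comm (x y : EuclideanSpace ℂ (Fin d)) : angle x y = angle y x := by
  rw [angle, angle, norm_inner_symm]

open Polynomial in
/-- The convolution of the zonal functions `|x* z|^(2i)` and `|y* z|^(2j)` over the unit sphere is a
polynomial of degree at most `j` in the angle. -/
theorem exists_integral_angle_pow_mul (hd : 2 ≤ d) (i j : ℕ) :
    ∃ P : ℝ[X], P.natDegree ≤ j ∧ ∀ x y : EuclideanSpace ℂ (Fin d), ‖x‖ = 1 → ‖y‖ = 1 →
      ∫ z, ((angle x z.1 ^ i * angle y z.1 ^ j : ℝ) : ℂ) ∂(sphereMeasure d) =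
        ((P.eval (angle x y) : ℝ) : ℂ) := by
  let e : ℕ → EuclideanSpace ℂ (Fin d) := fun k =>
    if h : k < d then EuclideanSpace.basisFun (Fin d) ℂ ⟨k, h⟩ else 0
  have he : Orthonormal ℂ ![e 0, e 1] := by
    have h0 : 0 < d := by omega
    have h1 : 1 < d := by omega
    rw [orthonormal_pair_iff]
    refine ⟨by simp [e, h0], by simp [e, h1], ?_⟩
    simp only [e, dif_pos h0, dif_pos h1]
    exact (EuclideanSpace.basisFun (Fin d) ℂ).orthonormal.2 (by simp)
  -- Moments of a fixed pair, so that the coefficients do not depend on `x` and `y`.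
  let c : ℕ → ℂ := fun p => mixedMoment (e 0) (e 1) (i + p) (j - p) (i + p) (j - p)
  have hc : ∀ p, c p = ((c p).re : ℂ) := by
    intro p
    have : c p = ∫ z, ((angle (e 0) z.1 ^ (i + p) * angle (e 1) z.1 ^ (j - p) : ℝ) : ℂ)
        ∂(sphereMeasure d) := by
      refine integral_congr_ae (Filter.Eventually.of_forall fun z => ?_)
      simp only
      push_cast
      rw [angle_eq_mul_star, angle_eq_mul_star]
      ring
    rw [this, integral_complex_ofReal, Complex.ofReal_re]
  -- Write `y = a x + b w` and expand both `(y* z)^j` and its conjugate. Only equal indices `p = q`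
  -- survive integration, and they contribute `|a|^(2p) |b|^(2(j-p))`, where `|a|²` is the angle and
  -- `|b|²` is one minus it.
  refine ⟨∑ p ∈ Finset.range (j + 1),
    C ((j.choose p : ℝ) ^ 2 * (c p).re) * (X ^ p * (1 - X) ^ (j - p)), ?_, ?_⟩
  · refine natDegree_sum_le_of_forall_le _ _ fun p hp => ?_
    refine (natDegree_C_mul_le _ _).trans (natDegree_mul_le.trans ?_)
    have h1 : (1 - X : ℝ[X]).natDegree ≤ 1 := by
      refine (natDegree_sub_le _ _).trans ?_
      simp
    have h2 := natDegree_pow_le_of_le (j - p) h1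
    rw [natDegree_X_pow]
    have := Finset.mem_range.1 hp
    omega
  · intro x y hx hy
    obtain ⟨w, b, hxw, hyb⟩ := exists_orthonormal_pair hd (y := y) hx
    set a : ℂ := inner ℂ x y with ha
    have hbb := norm_sq_coeff hxw hy hyb
    have haa := angle_eq_mul_star x y
    rw [← ha] at haa
    have hexp : ∀ z : EuclideanSpace ℂ (Fin d),
        ((angle x z ^ i * angle y z ^ j : ℝ) : ℂ) =
        ∑ p ∈ Finset.range (j + 1), ∑ q ∈ Finset.range (j + 1),
          (star a ^ p * star b ^ (j - p) * j.choose p * (a ^ q * b ^ (j - q) * j.choose q)) *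
          ((inner ℂ x z) ^ (i + p) * (inner ℂ w z) ^ (j - p) *
            (star (inner ℂ x z) ^ (i + q) * star (inner ℂ w z) ^ (j - q))) := by
      intro z
      have hyz : inner ℂ y z = star a * inner ℂ x z + star b * inner ℂ w z := by
        conv_lhs => rw [hyb]
        rw [inner_add_left, inner_smul_left, inner_smul_left]
        rfl
      push_cast
      rw [angle_eq_mul_star, angle_eq_mul_star, hyz, star_add, star_mul', star_mul', star_star,
        star_star, mul_pow, mul_pow, add_pow, add_pow, Finset.sum_mul_sum, Finset.mul_sum]
      refine Finset.sum_congr rfl fun p _ => ?_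
      rw [Finset.mul_sum]
      refine Finset.sum_congr rfl fun q _ => ?_
      ring
    simp_rw [hexp]
    rw [integral_finsetSum _ fun p _ => integrable_of_continuous (by omega) (by fun_prop)]
    rw [eval_finsetSum]
    push_cast
    refine Finset.sum_congr rfl fun p hp => ?_
    have hp' := Finset.mem_range.1 hp
    rw [integral_finsetSum _ fun q _ => integrable_of_continuous (by omega) (by fun_prop),
      Finset.sum_eq_single p]
    · rw [integral_const_mul]
      have : mixedMoment x w (i + p) (j - p) (i + p) (j - p) = ((c p).re : ℂ) := by
        rw [← hc, mixedMoment_eq hxw he]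
      rw [mixedMoment] at this
      rw [this]
      simp only [eval_mul, eval_C, eval_pow, eval_X, eval_sub, eval_one]
      push_cast at hbb ⊢
      rw [← hbb, haa]
      ring
    · intro q hq hqp
      have hq' := Finset.mem_range.1 hq
      rw [integral_const_mul]
      have := mixedMoment_eq_zero hxw (q := j - p) (q' := j - q) (by omega) (i + p) (i + q)
      rw [mixedMoment] at this
      rw [this, mul_zero]
    · intro h
      exact absurd hp h

end Sphere

/-! ### From the design property to the graded multiplication, and the general theorem. -/

section Design

variable {d : ℕ}

/-- The bidegree of the variables `z_i` and `z̄_i`. -/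
def biweight (d : ℕ) : Fin d ⊕ Fin d → ℕ × ℕ :=
  Sum.elim (fun _ => (1, 0)) (fun _ => (0, 1))

lemma weight_biweight (m : Fin d ⊕ Fin d →₀ ℕ) :
    Finsupp.weight (biweight d) m = (∑ i, m (Sum.inl i), ∑ i, m (Sum.inr i)) := by
  rw [Finsupp.weight_apply, Finsupp.sum_fintype _ _ (by simp)]
  simp [biweight, Fintype.sum_sum_type, Prod.ext_iff, Prod.fst_sum, Prod.snd_sum]

lemma isBihomogeneous_iff {f : MvPolynomial (Fin d ⊕ Fin d) ℂ} {k l : ℕ} :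
    IsBihomogeneous f k l ↔ f.IsWeightedHomogeneous (biweight d) (k, l) := by
  simp only [IsBihomogeneous, MvPolynomial.IsWeightedHomogeneous, MvPolynomial.mem_support_iff,
    weight_biweight, Prod.mk.injEq]

/-- The linear form `x* z`. -/
noncomputable def linearForm (x : EuclideanSpace ℂ (Fin d)) : MvPolynomial (Fin d ⊕ Fin d) ℂ :=
  ∑ i, MvPolynomial.C (star (x i)) * MvPolynomial.X (Sum.inl i)

/-- The conjugate linear form `z* x`. -/
noncomputable def conjForm (x : EuclideanSpace ℂ (Fin d)) : MvPolynomial (Fin d ⊕ Fin d) ℂ :=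
  ∑ i, MvPolynomial.C (x i) * MvPolynomial.X (Sum.inr i)

/-- The form `z* z`. -/
noncomputable def normForm (d : ℕ) : MvPolynomial (Fin d ⊕ Fin d) ℂ :=
  ∑ i, MvPolynomial.X (Sum.inl i) * MvPolynomial.X (Sum.inr i)

lemma evalConj_linearForm (x z : EuclideanSpace ℂ (Fin d)) :
    evalConj (linearForm x) z = inner ℂ x z := by
  simp [evalConj, linearForm, PiLp.inner_apply, mul_comm]

lemma evalConj_conjForm (x z : EuclideanSpace ℂ (Fin d)) :
    evalConj (conjForm x) z = star (inner ℂ x z) := by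
  simp [evalConj, conjForm, PiLp.inner_apply, mul_comm]

lemma evalConj_normForm {z : EuclideanSpace ℂ (Fin d)} (hz : ‖z‖ = 1) :
    evalConj (normForm d) z = 1 := by
  have h : (inner ℂ z z : ℂ) = 1 := by rw [inner_self_eq_norm_sq_to_K, hz]; simp
  rw [← h]
  simp only [evalConj, normForm, PiLp.inner_apply, map_sum, map_mul, MvPolynomial.eval_X,
    Sum.elim_inl, Sum.elim_inr]
  rfl

lemma evalConj_mul (f g : MvPolynomial (Fin d ⊕ Fin d) ℂ) (z : EuclideanSpace ℂ (Fin d)) :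
    evalConj (f * g) z = evalConj f z * evalConj g z := map_mul _ _ _

lemma evalConj_pow (f : MvPolynomial (Fin d ⊕ Fin d) ℂ) (n : ℕ) (z : EuclideanSpace ℂ (Fin d)) :
    evalConj (f ^ n) z = evalConj f z ^ n := map_pow _ _ _

lemma isWeightedHomogeneous_linearForm (x : EuclideanSpace ℂ (Fin d)) :
    (linearForm x).IsWeightedHomogeneous (biweight d) (1, 0) :=
  MvPolynomial.IsWeightedHomogeneous.sum _ _ _ fun i _ =>
    (MvPolynomial.isWeightedHomogeneous_X ℂ (biweight d) (Sum.inl i)).C_mul _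

lemma isWeightedHomogeneous_conjForm (x : EuclideanSpace ℂ (Fin d)) :
    (conjForm x).IsWeightedHomogeneous (biweight d) (0, 1) :=
  MvPolynomial.IsWeightedHomogeneous.sum _ _ _ fun i _ =>
    (MvPolynomial.isWeightedHomogeneous_X ℂ (biweight d) (Sum.inr i)).C_mul _

lemma isWeightedHomogeneous_normForm :
    (normForm d).IsWeightedHomogeneous (biweight d) (1, 1) :=
  MvPolynomial.IsWeightedHomogeneous.sum _ _ _ fun i _ =>
    (MvPolynomial.isWeightedHomogeneous_X ℂ (biweight d) (Sum.inl i)).mul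
      (MvPolynomial.isWeightedHomogeneous_X ℂ (biweight d) (Sum.inr i))

/-- Multiplying by a power of `z* z`, which is `1` on the sphere, raises the bidegree `(i + j, i +
j)` to `(t, t)`. -/
lemma IsDesign.sum_angle_pow_mul {X : Finset (EuclideanSpace ℂ (Fin d))} {t : ℕ}
    (hX : IsDesign X t) (x y : EuclideanSpace ℂ (Fin d)) {i j : ℕ} (hij : i + j ≤ t) :
    (1 / (X.card : ℂ)) * ∑ z ∈ X, ((angle x z ^ i * angle y z ^ j : ℝ) : ℂ) =
      ∫ z, ((angle x z.1 ^ i * angle y z.1 ^ j : ℝ) : ℂ) ∂(sphereMeasure d) := by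
  set f := (linearForm x * conjForm x) ^ i * (linearForm y * conjForm y) ^ j *
    normForm d ^ (t - i - j) with hf
  have hhom : IsBihomogeneous f t t := by
    rw [isBihomogeneous_iff]
    have := ((((isWeightedHomogeneous_linearForm x).mul
      (isWeightedHomogeneous_conjForm x)).pow i).mul
      (((isWeightedHomogeneous_linearForm y).mul (isWeightedHomogeneous_conjForm y)).pow j)).mul
      ((isWeightedHomogeneous_normForm (d := d)).pow (t - i - j))
    convert this using 1
    simp only [Prod.mk_add_mk, Prod.smul_mk, smul_eq_mul, Prod.mk.injEq]
    omega
  have hval : ∀ z : EuclideanSpace ℂ (Fin d), ‖z‖ = 1 →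
      evalConj f z = ((angle x z ^ i * angle y z ^ j : ℝ) : ℂ) := by
    intro z hz
    rw [hf]
    simp only [evalConj_mul, evalConj_pow, evalConj_linearForm, evalConj_conjForm,
      evalConj_normForm hz, one_pow, mul_one]
    push_cast
    rw [angle_eq_mul_star, angle_eq_mul_star]
  have := hX.average f hhom
  rw [Finset.sum_congr rfl fun z hz => hval z (hX.unit z hz)] at this
  rw [this]
  exact integral_congr_ae (Filter.Eventually.of_forall fun z => hval z.1 (by simp))

lemma Polynomial.eval_eq_sum_of_degree_lt {p : Polynomial ℝ} {n : ℕ}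
    (hp : p.degree < (n : WithBot ℕ)) (t : ℝ) :
    p.eval t = ∑ i ∈ Finset.range n, p.coeff i * t ^ i := by
  by_cases h : p = 0
  · simp [h]
  · exact Polynomial.eval_eq_sum_range' ((Polynomial.natDegree_lt_iff_degree_lt h).2 hp) t

-- Both exponents are at most `s - 1`, so their sum is within the strength of the design; the matrix
-- product becomes `|X|` times a convolution over the sphere, whose degree is bounded by that of the
-- right factor.
open Polynomial in
lemma IsDesign.mulClosed (hd : 2 ≤ d) {X : Finset (EuclideanSpace ℂ (Fin d))} {s : ℕ}
    (hX : IsDesign X (2 * (s - 1))) (hne : X.Nonempty) :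
    schurEval.MulClosed (fun a b : X => angle a.1 b.1) s := by
  intro p q hp k hk hq
  choose P hPdeg hP using exists_integral_angle_pow_mul (d := d) hd
  refine ⟨∑ i ∈ Finset.range s, ∑ j ∈ Finset.range k,
    (p.coeff i * q.coeff j * X.card) • P i j, ?_, ?_⟩
  · rw [← mem_degreeLT]
    refine Submodule.sum_mem _ fun i _ => Submodule.sum_mem _ fun j hj =>
      Submodule.smul_mem _ _ (mem_degreeLT.2 ?_)
    refine degree_le_natDegree.trans_lt ?_
    exact_mod_cast (hPdeg i j).trans_lt (Finset.mem_range.1 hj)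
  · ext a b
    have hn : (X.card : ℂ) ≠ 0 := by simpa using hne.ne_empty
    have key : ∀ i ∈ Finset.range s, ∀ j ∈ Finset.range k,
        ∑ z : X, ((angle a.1 z.1 ^ i * angle z.1 b.1 ^ j : ℝ) : ℂ) =
          ((X.card * (P i j).eval (angle a.1 b.1) : ℝ) : ℂ) := by
      intro i hi j hj
      have hi := Finset.mem_range.1 hi
      have hj := Finset.mem_range.1 hj
      have h := hX.sum_angle_pow_mul a.1 b.1 (i := i) (j := j) (by omega)
      rw [hP i j a.1 b.1 (hX.unit _ a.2) (hX.unit _ b.2)] at h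
      push_cast
      rw [← h, ← mul_assoc, mul_one_div_cancel hn, one_mul, ← Finset.sum_coe_sort X]
      refine Finset.sum_congr rfl fun z _ => ?_
      rw [angle_comm z.1 b.1]
      push_cast
      rfl
    simp only [Matrix.mul_apply, schurEval.apply, eval_finsetSum, eval_smul, smul_eq_mul]
    calc ∑ z : X, ((p.eval (angle a.1 z.1) : ℝ) : ℂ) * ((q.eval (angle z.1 b.1) : ℝ) : ℂ)
        = ∑ z : X, ∑ i ∈ Finset.range s, ∑ j ∈ Finset.range k,
            ((p.coeff i * q.coeff j : ℝ) : ℂ) *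
              ((angle a.1 z.1 ^ i * angle z.1 b.1 ^ j : ℝ) : ℂ) := by
          refine Finset.sum_congr rfl fun z _ => ?_
          rw [Polynomial.eval_eq_sum_of_degree_lt hp, Polynomial.eval_eq_sum_of_degree_lt hq,
            ← Complex.ofReal_mul, Finset.sum_mul_sum]
          push_cast
          refine Finset.sum_congr rfl fun i _ => Finset.sum_congr rfl fun j _ => ?_
          ring
      _ = ∑ i ∈ Finset.range s, ∑ j ∈ Finset.range k, ((p.coeff i * q.coeff j : ℝ) : ℂ) *
            ∑ z : X, ((angle a.1 z.1 ^ i * angle z.1 b.1 ^ j : ℝ) : ℂ) := by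
          rw [Finset.sum_comm]
          refine Finset.sum_congr rfl fun i _ => ?_
          rw [Finset.sum_comm]
          refine Finset.sum_congr rfl fun j _ => ?_
          rw [Finset.mul_sum]
      _ = _ := by
          push_cast
          refine Finset.sum_congr rfl fun i hi => Finset.sum_congr rfl fun j hj => ?_
          have := key i hi j hj
          push_cast at this
          rw [this]
          ring

lemma angle_self {x : EuclideanSpace ℂ (Fin d)} (hx : ‖x‖ = 1) : angle x x = 1 := by
  rw [angle, inner_self_eq_norm_sq_to_K, hx]
  simp

lemma IsDistanceSet.angle_eq_one_iff {X : Set (EuclideanSpace ℂ (Fin d))} {s : ℕ}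
    (hX : IsDistanceSet X s) {x y : EuclideanSpace ℂ (Fin d)} (hx : x ∈ X) (hy : y ∈ X) :
    angle x y = 1 ↔ x = y := by
  constructor
  · intro h
    by_contra hxy
    exact hX.lines ⟨x, hx, y, hy, hxy, h⟩
  · rintro rfl
    exact angle_self (hX.unit x hx)

lemma IsDistanceSet.exists_ne {X : Set (EuclideanSpace ℂ (Fin d))} {s : ℕ}
    (hX : IsDistanceSet X s) (hs : 1 ≤ s) : ∃ x ∈ X, ∃ y ∈ X, x ≠ y := by
  have : (degreeSet X).Nonempty := by
    rw [Set.nonempty_iff_ne_empty]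
    intro h
    have := hX.card
    rw [h, Set.encard_empty] at this
    have : s = 0 := by exact_mod_cast this.symm
    omega
  obtain ⟨_, x, hx, y, hy, hxy, -⟩ := this
  exact ⟨x, hx, y, hy, hxy⟩

/-- In dimension at most one there are no two distinct lines. -/
lemma IsDistanceSet.two_le_dim {X : Set (EuclideanSpace ℂ (Fin d))} {s : ℕ}
    (hX : IsDistanceSet X s) (hs : 1 ≤ s) : 2 ≤ d := by
  obtain ⟨x, hx, y, hy, hxy⟩ := hX.exists_ne hs
  by_contra! h
  have hd : d = 0 ∨ d = 1 := by omega
  rcases hd with rfl | rfl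
  · exact hxy (Subsingleton.elim x y)
  · refine hxy ((hX.angle_eq_one_iff hx hy).1 ?_)
    have h1 := hX.unit x hx
    have h2 := hX.unit y hy
    rw [EuclideanSpace.norm_eq, Real.sqrt_eq_one] at h1 h2
    simp only [Finset.univ_unique, Fin.default_eq_zero, Finset.sum_singleton] at h1 h2
    rw [angle, PiLp.inner_apply]
    simp [mul_pow, h1, h2]

/-- An `s`-distance set which is a `2(s-1)`-design carries a `Q`-polynomial association scheme. -/
theorem anglesFormQPolynomialScheme_of_design {s : ℕ} {X : Finset (EuclideanSpace ℂ (Fin d))}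
    (hs : 1 ≤ s) (hX : IsDistanceSet (X : Set (EuclideanSpace ℂ (Fin d))) s)
    (hdes : IsDesign X (2 * (s - 1))) : AnglesFormQPolynomialScheme X s := by
  intro α hα
  obtain ⟨x, hx, -⟩ := hX.exists_ne hs
  have hmem : ∀ i : Fin s, α i.succ ∈ degreeSet (X : Set (EuclideanSpace ℂ (Fin d))) :=
    fun i => hα.range ▸ Set.mem_range_self i
  have hne : ∀ i : Fin s, α i.succ ≠ 1 := fun i h => hX.lines (h ▸ hmem i)
  have hinj : Function.Injective α := by
    intro i j hij
    induction i using Fin.cases with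
    | zero =>
      induction j using Fin.cases with
      | zero => rfl
      | succ j => exact absurd (hij.symm.trans hα.zero) (hne j)
    | succ i =>
      induction j using Fin.cases with
      | zero => exact absurd (hij.trans hα.zero) (hne i)
      | succ j => rw [hα.injective hij]
  refine schurEval.scheme_of_mulClosed (T := fun a b : X => angle a.1 b.1)
    (fun a b => angle_comm _ _) hs hinj ?_ ?_ ?_
    (hdes.mulClosed (hX.two_le_dim hs) ⟨x, hx⟩) ?_ ?_
  · intro i
    induction i using Fin.cases with
    | zero => exact ⟨⟨x, hx⟩, ⟨x, hx⟩, by rw [angle_self (hX.unit x hx), hα.zero]⟩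
    | succ i =>
      obtain ⟨a, ha, b, hb, -, hab⟩ := hmem i
      exact ⟨⟨a, ha⟩, ⟨b, hb⟩, hab⟩
  · intro a b
    by_cases hab : a.1 = b.1
    · exact ⟨0, by rw [(hX.angle_eq_one_iff a.2 b.2).2 hab, hα.zero]⟩
    · have : angle a.1 b.1 ∈ degreeSet (X : Set (EuclideanSpace ℂ (Fin d))) :=
        ⟨a.1, a.2, b.1, b.2, hab, rfl⟩
      rw [← hα.range] at this
      obtain ⟨i, hi⟩ := this
      exact ⟨i.succ, hi.symm⟩
  · intro a b
    rw [hα.zero, hX.angle_eq_one_iff a.2 b.2, Subtype.ext_iff]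
  · intro i a b h
    simpa [angleMatrix] using h
  · intro i a b h
    simpa [angleMatrix] using h

end Design

/-! ### Finiteness, equiangular lines, and a criterion for designs. -/

section Examples

variable {d : ℕ}

@[fun_prop]
lemma continuous_angle {Z : Type*} [TopologicalSpace Z] {f g : Z → EuclideanSpace ℂ (Fin d)}
    (hf : Continuous f) (hg : Continuous g) : Continuous fun z => angle (f z) (g z) := by
  unfold angle
  fun_prop

/-- A set of unit vectors with finitely many angles is finite. -/
lemma IsDistanceSet.finite {X : Set (EuclideanSpace ℂ (Fin d))} {s : ℕ}
    (hX : IsDistanceSet X s) : X.Finite := by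
  by_contra hinf
  obtain ⟨x, hx, hacc⟩ := Set.Infinite.exists_accPt_of_subset_isCompact hinf
    (isCompact_sphere (0 : EuclideanSpace ℂ (Fin d)) 1) fun y hy => by simpa using hX.unit y hy
  have hfin : (degreeSet X).Finite := Set.finite_of_encard_eq_coe hX.card
  -- The angle at `(x, x)` is `1`, which the finite degree set avoids, so no two distinct points of
  -- `X` can both be close to the accumulation point `x`.
  have hopen : IsOpen ((fun p : EuclideanSpace ℂ (Fin d) × EuclideanSpace ℂ (Fin d) =>
      angle p.1 p.2) ⁻¹' (degreeSet X)ᶜ) :=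
    hfin.isClosed.isOpen_compl.preimage (by fun_prop)
  have hxx : (x, x) ∈ ((fun p : EuclideanSpace ℂ (Fin d) × EuclideanSpace ℂ (Fin d) =>
      angle p.1 p.2) ⁻¹' (degreeSet X)ᶜ) := by
    simp only [Set.mem_preimage, angle_self (mem_sphere_zero_iff_norm.1 hx)]
    exact hX.lines
  have hnhds := hopen.mem_nhds hxx
  rw [nhds_prod_eq] at hnhds
  obtain ⟨U, hU, hUU⟩ := Filter.mem_prod_same_iff.1 hnhds
  rw [accPt_iff_nhds] at hacc
  obtain ⟨y, ⟨hyU, hyX⟩, hyx⟩ := hacc U hU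
  -- The limit `x` need not lie in `X`, so a second point of `X` is found by removing `y` from the
  -- neighbourhood.
  obtain ⟨y', ⟨⟨hyU', hyy'⟩, hyX'⟩, -⟩ :=
    hacc (U ∩ {y}ᶜ) (Filter.inter_mem hU (isOpen_compl_singleton.mem_nhds (Ne.symm hyx)))
  exact hUU (Set.mk_mem_prod hyU hyU') ⟨y, hyX, y', hyX', fun h => hyy' h.symm, rfl⟩

/-- Every nonempty finite set of unit vectors is a `0`-design. -/
lemma isDesign_zero (hd : d ≠ 0) {X : Finset (EuclideanSpace ℂ (Fin d))} (hne : X.Nonempty)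
    (hX : ∀ x ∈ X, ‖x‖ = 1) : IsDesign X 0 := by
  refine ⟨hX, fun f hf => ?_⟩
  have := isProbabilityMeasure_sphereMeasure hd
  have hfC : f = MvPolynomial.C (f.coeff 0) := by
    ext m
    rw [MvPolynomial.coeff_C]
    split_ifs with h
    · rw [h]
    · by_contra h0
      apply h
      obtain ⟨h1, h2⟩ := hf m (MvPolynomial.mem_support_iff.2 h0)
      rw [Finset.sum_eq_zero_iff] at h1 h2
      ext (i | i)
      · exact (h1 i (Finset.mem_univ _)).symm
      · exact (h2 i (Finset.mem_univ _)).symm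
  have hn : (X.card : ℂ) ≠ 0 := by simpa using hne.ne_empty
  rw [hfC]
  simp [evalConj, hn]

/-- Every `1`-distance set is finite and carries a `Q`-polynomial association scheme. -/
theorem equiangular_scheme {X : Set (EuclideanSpace ℂ (Fin d))} (hX : IsDistanceSet X 1) :
    ∃ Y : Finset (EuclideanSpace ℂ (Fin d)), (Y : Set (EuclideanSpace ℂ (Fin d))) = X ∧
      IsDesign Y (2 * (1 - 1)) ∧ AnglesFormQPolynomialScheme Y 1 := by
  have hcoe := hX.finite.coe_toFinset
  obtain ⟨x, hx, -⟩ := hX.exists_ne le_rfl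
  have hd := hX.two_le_dim le_rfl
  have hdes : IsDesign hX.finite.toFinset (2 * (1 - 1)) :=
    isDesign_zero (by omega) ⟨x, by simpa using hx⟩ fun y hy => hX.unit y (by simpa using hy)
  exact ⟨_, hcoe, hdes, anglesFormQPolynomialScheme_of_design le_rfl (by rwa [hcoe]) hdes⟩

/-! ### Designs from the frame potential -/

/-- The `(I, J)` coordinate of `z^{⊗t} ⊗ z̄^{⊗t}`. -/
def tensorCoord {t : ℕ} (z : EuclideanSpace ℂ (Fin d)) (K : (Fin t → Fin d) × (Fin t → Fin d)) :
    ℂ :=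
  (∏ k, z (K.1 k)) * ∏ k, star (z (K.2 k))

lemma continuous_tensorCoord {t : ℕ} (K : (Fin t → Fin d) × (Fin t → Fin d)) :
    Continuous fun z : Metric.sphere (0 : EuclideanSpace ℂ (Fin d)) 1 => tensorCoord z.1 K := by
  unfold tensorCoord
  fun_prop

/-- The inner product of tensor powers is the power of the inner product. -/
lemma sum_tensorCoord_mul_star {t : ℕ} (z w : EuclideanSpace ℂ (Fin d)) :
    ∑ K : (Fin t → Fin d) × (Fin t → Fin d), tensorCoord z K * star (tensorCoord w K) =
      ((angle w z ^ t : ℝ) : ℂ) := by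
  push_cast
  rw [angle_eq_mul_star, mul_pow, PiLp.inner_apply, star_sum, Fintype.sum_pow, Fintype.sum_pow,
    Finset.sum_mul_sum, Fintype.sum_prod_type]
  refine Finset.sum_congr rfl fun I _ => Finset.sum_congr rfl fun J _ => ?_
  simp only [tensorCoord, star_mul', RCLike.inner_apply, Finset.prod_mul_distrib,
    map_prod, RCLike.star_def, RingHomCompTriple.comp_apply, RingHom.id_apply]
  ring

/-- A monomial of degree `t` is spelled out as a word of length `t`, matching it with a tensor
coordinate. -/
lemma exists_prod_pow_eq {t : ℕ} (m : Fin d → ℕ) (hm : ∑ i, m i = t) :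
    ∃ I : Fin t → Fin d, ∀ z : Fin d → ℂ, ∏ i, z i ^ m i = ∏ k, z (I k) := by
  obtain ⟨l, hl⟩ := Quot.exists_rep (∑ i, m i • ({i} : Multiset (Fin d)) : Multiset (Fin d))
  have hcard : l.length = t := by
    have := congrArg Multiset.card hl
    simpa [Multiset.card_sum, hm] using this
  subst hcard
  refine ⟨fun k => l[(k : ℕ)], fun z => ?_⟩
  have := congrArg (fun s : Multiset (Fin d) => (s.map z).prod) hl
  refine Eq.trans ?_ (Fin.prod_univ_fun_getElem l z).symm
  have hmap : (∑ i, m i • ({i} : Multiset (Fin d))).map z = ∑ i, m i • ({z i} : Multiset ℂ) := by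
    rw [← Multiset.coe_mapAddMonoidHom, map_sum]
    simp [Multiset.map_nsmul]
  rw [hmap, Multiset.prod_sum] at this
  simpa [Multiset.prod_nsmul] using this.symm

lemma exists_evalConj_eq_sum (hd : d ≠ 0) {t : ℕ} {f : MvPolynomial (Fin d ⊕ Fin d) ℂ}
    (hf : IsBihomogeneous f t t) :
    ∃ K : (Fin d ⊕ Fin d →₀ ℕ) → (Fin t → Fin d) × (Fin t → Fin d),
      ∀ z, evalConj f z = ∑ m ∈ f.support, f.coeff m * tensorCoord z (K m) := by
  have key : ∀ m ∈ f.support, ∃ K : (Fin t → Fin d) × (Fin t → Fin d),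
      ∀ z : EuclideanSpace ℂ (Fin d),
      ∏ i, Sum.elim (fun i => z i) (fun i => star (z i)) i ^ m i = tensorCoord z K := by
    intro m hm
    obtain ⟨I, hI⟩ := exists_prod_pow_eq _ (hf m hm).1
    obtain ⟨J, hJ⟩ := exists_prod_pow_eq _ (hf m hm).2
    refine ⟨(I, J), fun z => ?_⟩
    rw [Fintype.prod_sum_type, tensorCoord]
    simp only [Sum.elim_inl, Sum.elim_inr]
    rw [hI, hJ]
  -- Supplies the default value of `K` off the support.
  have : NeZero d := ⟨hd⟩
  choose! K hK using key
  refine ⟨K, fun z => ?_⟩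
  rw [evalConj, MvPolynomial.eval_eq']
  exact Finset.sum_congr rfl fun m hm => by rw [hK m hm]

/-- A finite set of unit vectors whose frame potential attains the Welch bound is a design. -/
theorem isDesign_of_framePotential (hd : d ≠ 0) {t : ℕ} {X : Finset (EuclideanSpace ℂ (Fin d))}
    (hne : X.Nonempty) (hX : ∀ x ∈ X, ‖x‖ = 1) {c : ℂ}
    (hc : ∀ x : EuclideanSpace ℂ (Fin d), ‖x‖ = 1 →
      ∫ z, ((angle x z.1 ^ t : ℝ) : ℂ) ∂(sphereMeasure d) = c)
    (hpot : ∀ x ∈ X, (1 / (X.card : ℂ)) * ∑ y ∈ X, ((angle x y ^ t : ℝ) : ℂ) = c) :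
    IsDesign X t := by
  have := isProbabilityMeasure_sphereMeasure hd
  have hn : (X.card : ℂ) ≠ 0 := by simpa using hne.ne_empty
  -- `D` is the average tensor over `X` minus that over the sphere; its vanishing gives the design
  -- property.
  set D : (Fin t → Fin d) × (Fin t → Fin d) → ℂ := fun K =>
    (1 / (X.card : ℂ)) * ∑ x ∈ X, tensorCoord x K -
      ∫ z, tensorCoord z.1 K ∂(sphereMeasure d) with hD
  have hint : ∀ K : (Fin t → Fin d) × (Fin t → Fin d),
      Integrable (fun z : Metric.sphere (0 : EuclideanSpace ℂ (Fin d)) 1 => tensorCoord z.1 K)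
        (sphereMeasure d) := fun K => integrable_of_continuous hd (continuous_tensorCoord K)
  have hpair : ∀ w : EuclideanSpace ℂ (Fin d), ‖w‖ = 1 →
      ∑ K, star (tensorCoord w K) * D K =
        (1 / (X.card : ℂ)) * ∑ x ∈ X, ((angle w x ^ t : ℝ) : ℂ) - c := by
    intro w hw
    simp only [hD, mul_sub, Finset.sum_sub_distrib]
    congr 1
    · simp only [Finset.mul_sum]
      rw [Finset.sum_comm]
      refine Finset.sum_congr rfl fun x _ => ?_
      rw [← sum_tensorCoord_mul_star, Finset.mul_sum]
      exact Finset.sum_congr rfl fun K _ => by ring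
    · rw [← hc w hw]
      simp_rw [← sum_tensorCoord_mul_star, ← integral_const_mul]
      rw [integral_finsetSum _ fun K _ => (hint K).mul_const _]
      exact Finset.sum_congr rfl fun K _ => by simp only [mul_comm]
  have hstar : ∀ K, star (D K) = (1 / (X.card : ℂ)) * ∑ x ∈ X, star (tensorCoord x K) -
      ∫ z, star (tensorCoord z.1 K) ∂(sphereMeasure d) := by
    intro K
    simp only [hD, star_sub, star_mul', star_sum, RCLike.star_def, integral_conj]
    simp
  -- Expand only the conjugated factor. Pairing `D` with points of `X` gives zero by `hpot`; pairing
  -- it with the sphere gives zero after exchanging sum and integral, by `hc`.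
  have hzero : ∑ K, star (D K) * D K = 0 := by
    simp only [hstar, sub_mul, Finset.sum_sub_distrib]
    have h1 : ∑ K, (1 / (X.card : ℂ)) * (∑ x ∈ X, star (tensorCoord x K)) * D K = 0 := by
      calc ∑ K, (1 / (X.card : ℂ)) * (∑ x ∈ X, star (tensorCoord x K)) * D K
          = (1 / (X.card : ℂ)) * ∑ x ∈ X, ∑ K, star (tensorCoord x K) * D K := by
            rw [Finset.sum_comm, Finset.mul_sum]
            refine Finset.sum_congr rfl fun K _ => ?_
            rw [← Finset.sum_mul, mul_assoc]
        _ = 0 := by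
            rw [Finset.sum_eq_zero, mul_zero]
            intro x hx
            rw [hpair x (hX x hx), hpot x hx, sub_self]
    have h2 : ∑ K, (∫ z, star (tensorCoord z.1 K) ∂(sphereMeasure d)) * D K = 0 := by
      have hcont : ∀ K : (Fin t → Fin d) × (Fin t → Fin d),
          Continuous fun z : Metric.sphere (0 : EuclideanSpace ℂ (Fin d)) 1 =>
            star (tensorCoord z.1 K) * D K :=
        fun K => (continuous_tensorCoord K).star.mul continuous_const
      simp_rw [← integral_mul_const]
      rw [← integral_finsetSum _ fun K _ => integrable_of_continuous hd (hcont K)]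
      have : ∀ z : Metric.sphere (0 : EuclideanSpace ℂ (Fin d)) 1,
          ∑ K, star (tensorCoord z.1 K) * D K =
            (1 / (X.card : ℂ)) * ∑ x ∈ X, ((angle x z.1 ^ t : ℝ) : ℂ) - c := by
        intro z
        rw [hpair z.1 (by simp)]
        simp only [angle_comm z.1]
      simp_rw [this]
      rw [integral_sub (integrable_of_continuous hd (by fun_prop)) (integrable_const _),
        integral_const_mul,
        integral_finsetSum _ fun x _ => integrable_of_continuous hd (by fun_prop),
        Finset.sum_congr rfl fun x hx => hc x (hX x hx)]
      simp [hn]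
    rw [h1, h2, sub_zero]
  have hD0 : ∀ K, D K = 0 := by
    have hre : ∑ K, ‖D K‖ ^ 2 = 0 := by
      have : ((∑ K, ‖D K‖ ^ 2 : ℝ) : ℂ) = 0 := by
        rw [← hzero]
        push_cast
        exact Finset.sum_congr rfl fun K _ => (RCLike.conj_mul (D K)).symm
      exact_mod_cast this
    intro K
    have := (Finset.sum_eq_zero_iff_of_nonneg fun K _ => sq_nonneg _).1 hre K (Finset.mem_univ _)
    simpa using this
  refine ⟨hX, fun f hf => ?_⟩
  obtain ⟨K, hK⟩ := exists_evalConj_eq_sum hd hf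
  simp_rw [hK]
  rw [integral_finsetSum _ fun m _ => (hint (K m)).const_mul _, Finset.sum_comm, Finset.mul_sum]
  refine Finset.sum_congr rfl fun m _ => ?_
  rw [integral_const_mul, ← Finset.mul_sum, ← sub_eq_zero.1 (hD0 (K m))]
  ring

end Examples

/-! ### The second moment of the sphere and mutually unbiased bases. -/

section Unbiased

variable {d : ℕ}

/-- Averaging over the fourth roots of unity removes all phase-dependent terms. -/
lemma Complex.sum_norm_add_pow_four (p q : ℂ) :
    (‖p + q‖ ^ 2) ^ 2 + (‖p - q‖ ^ 2) ^ 2 + (‖p + Complex.I * q‖ ^ 2) ^ 2 +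
      (‖p - Complex.I * q‖ ^ 2) ^ 2 =
      4 * ((‖p‖ ^ 2) ^ 2 + (‖q‖ ^ 2) ^ 2 + 4 * (‖p‖ ^ 2 * ‖q‖ ^ 2)) := by
  simp only [Complex.sq_norm, Complex.normSq_apply, Complex.add_re, Complex.add_im, Complex.sub_re,
    Complex.sub_im, Complex.mul_re, Complex.mul_im, Complex.I_re, Complex.I_im]
  ring

/-- The vector `(x + ω w) / √2`. -/
noncomputable def halfSum (x w : EuclideanSpace ℂ (Fin d)) (ω : ℂ) : EuclideanSpace ℂ (Fin d) :=
  ((Real.sqrt 2)⁻¹ : ℂ) • (x + ω • w)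

lemma norm_halfSum {x w : EuclideanSpace ℂ (Fin d)} (h : Orthonormal ℂ ![x, w]) {ω : ℂ}
    (hω : ‖ω‖ = 1) : ‖halfSum x w ω‖ = 1 := by
  obtain ⟨hx, hw, hxw⟩ := orthonormal_pair_iff.1 h
  have h1 : ‖x + ω • w‖ * ‖x + ω • w‖ = ‖x‖ * ‖x‖ + ‖ω • w‖ * ‖ω • w‖ :=
    norm_add_sq_eq_norm_sq_add_norm_sq_of_inner_eq_zero (𝕜 := ℂ) _ _
      (by rw [inner_smul_right, hxw, mul_zero])
  rw [norm_smul, hω, hx, hw] at h1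
  have h2 : ‖x + ω • w‖ = Real.sqrt 2 := by
    rw [← Real.sqrt_mul_self (norm_nonneg (x + ω • w)), h1]
    norm_num
  rw [halfSum, norm_smul, h2, norm_inv, Complex.norm_real, Real.norm_of_nonneg (Real.sqrt_nonneg 2)]
  exact inv_mul_cancel₀ (by positivity)

lemma angle_halfSum (x w z : EuclideanSpace ℂ (Fin d)) (ω : ℂ) :
    angle (halfSum x w ω) z = ‖inner ℂ x z + star ω * inner ℂ w z‖ ^ 2 / 2 := by
  rw [angle, halfSum, inner_smul_left, inner_add_left, inner_smul_left, norm_mul, mul_pow,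
    RCLike.norm_conj, norm_inv, Complex.norm_real, Real.norm_of_nonneg (Real.sqrt_nonneg 2),
    inv_pow, Real.sq_sqrt (by norm_num), RCLike.star_def]
  ring

/-- The fourth moment of a coordinate is independent of the coordinate. -/
lemma integral_angle_pow_eq {x y : EuclideanSpace ℂ (Fin d)} (hx : ‖x‖ = 1) (hy : ‖y‖ = 1)
    (t : ℕ) :
    ∫ z, ((angle x z.1 ^ t : ℝ) : ℂ) ∂(sphereMeasure d) =
      ∫ z, ((angle y z.1 ^ t : ℝ) : ℂ) ∂(sphereMeasure d) := by
  refine integral_orthonormal (v := fun _ : Fin 1 => x) (v' := fun _ => y)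
    (by simpa [orthonormal_subsingleton_iff] using hx)
    (by simpa [orthonormal_subsingleton_iff] using hy)
    (G := fun u => (((‖u 0‖ ^ 2) ^ t : ℝ) : ℂ)) (by fun_prop)

/-- The four unit vectors `(x + ω w) / √2` with `ω⁴ = 1` have the same moment `A` as `x` and `w`.
With `M` the mixed moment, the identity above integrates to `4A = 2A + 4M`. -/
lemma integral_angle_sq_eq_two_mul (hd : d ≠ 0) {x w : EuclideanSpace ℂ (Fin d)}
    (h : Orthonormal ℂ ![x, w]) :
    ∫ z, ((angle x z.1 ^ 2 : ℝ) : ℂ) ∂(sphereMeasure d) =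
      2 * ∫ z, ((angle x z.1 * angle w z.1 : ℝ) : ℂ) ∂(sphereMeasure d) := by
  obtain ⟨hx, hw, -⟩ := orthonormal_pair_iff.1 h
  have hpt : ∀ z : EuclideanSpace ℂ (Fin d),
      ((angle (halfSum x w 1) z ^ 2 : ℝ) : ℂ) + ((angle (halfSum x w (-1)) z ^ 2 : ℝ) : ℂ) +
        ((angle (halfSum x w Complex.I) z ^ 2 : ℝ) : ℂ) +
        ((angle (halfSum x w (-Complex.I)) z ^ 2 : ℝ) : ℂ) =
      ((angle x z ^ 2 : ℝ) : ℂ) + ((angle w z ^ 2 : ℝ) : ℂ) +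
        4 * ((angle x z * angle w z : ℝ) : ℂ) := by
    intro z
    have := Complex.sum_norm_add_pow_four (inner ℂ x z) (inner ℂ w z)
    rw [← sub_eq_zero]
    simp only [angle_halfSum, star_one, star_neg, RCLike.star_def, Complex.conj_I, one_mul, neg_mul, neg_neg,
      ← sub_eq_add_neg, div_pow]
    simp only [angle]
    norm_cast
    linarith
  have hI := congrArg (fun F : EuclideanSpace ℂ (Fin d) → ℂ => ∫ z, F z.1 ∂(sphereMeasure d))
    (funext hpt)
  rw [integral_add (integrable_of_continuous hd (by fun_prop))
      (integrable_of_continuous hd (by fun_prop)),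
    integral_add (integrable_of_continuous hd (by fun_prop))
      (integrable_of_continuous hd (by fun_prop)),
    integral_add (integrable_of_continuous hd (by fun_prop))
      (integrable_of_continuous hd (by fun_prop)),
    integral_add (integrable_of_continuous hd (by fun_prop))
      (integrable_of_continuous hd (by fun_prop)),
    integral_add (integrable_of_continuous hd (by fun_prop))
      (integrable_of_continuous hd (by fun_prop)),
    integral_const_mul] at hI
  rw [integral_angle_pow_eq (norm_halfSum h (ω := 1) (by simp)) hx,
    integral_angle_pow_eq (norm_halfSum h (ω := -1) (by simp)) hx,
    integral_angle_pow_eq (norm_halfSum h (ω := Complex.I) (by simp)) hx,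
    integral_angle_pow_eq (norm_halfSum h (ω := -Complex.I) (by simp)) hx,
    integral_angle_pow_eq hw hx] at hI
  linear_combination hI / 2

/-- Parseval's identity. -/
lemma sum_angle_basis (b : OrthonormalBasis (Fin d) ℂ (EuclideanSpace ℂ (Fin d)))
    {z : EuclideanSpace ℂ (Fin d)} (hz : ‖z‖ = 1) : ∑ k, angle (b k) z = 1 := by
  have := b.sum_sq_norm_inner_right z
  rw [hz, one_pow] at this
  exact this

lemma angle_basis (b : OrthonormalBasis (Fin d) ℂ (EuclideanSpace ℂ (Fin d))) (k l : Fin d) :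
    angle (b k) (b l) = if k = l then 1 else 0 := by
  rw [angle, orthonormal_iff_ite.1 b.orthonormal]
  split_ifs <;> simp

theorem integral_angle_sq (hd : d ≠ 0) {x : EuclideanSpace ℂ (Fin d)} (hx : ‖x‖ = 1) :
    ∫ z, ((angle x z.1 ^ 2 : ℝ) : ℂ) ∂(sphereMeasure d) = 2 / (d * (d + 1)) := by
  have := isProbabilityMeasure_sphereMeasure hd
  let b := EuclideanSpace.basisFun (Fin d) ℂ
  have hb : ∀ k, ‖b k‖ = 1 := b.orthonormal.1
  set A := ∫ z, ((angle x z.1 ^ 2 : ℝ) : ℂ) ∂(sphereMeasure d) with hA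
  have hAk : ∀ k, ∫ z, ((angle (b k) z.1 ^ 2 : ℝ) : ℂ) ∂(sphereMeasure d) = A :=
    fun k => integral_angle_pow_eq (hb k) hx 2
  have hkl : ∀ k l, ∫ z, ((angle (b k) z.1 * angle (b l) z.1 : ℝ) : ℂ) ∂(sphereMeasure d) =
      A / 2 + if k = l then A / 2 else 0 := by
    intro k l
    split_ifs with h
    · subst h
      rw [add_halves, ← hAk k]
      simp only [sq]
    · have hpair : Orthonormal ℂ ![b k, b l] :=
        orthonormal_pair_iff.2 ⟨hb k, hb l, b.orthonormal.2 h⟩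
      rw [← hAk k, integral_angle_sq_eq_two_mul hd hpair]
      ring
  -- Integrating the square of Parseval's identity gives `d` terms `A` and `d(d-1)` terms `A / 2`
  -- with total `1`.
  have hone : ∑ k, ∑ l,
      ∫ z, ((angle (b k) z.1 * angle (b l) z.1 : ℝ) : ℂ) ∂(sphereMeasure d) = 1 := by
    have hint : ∀ k l, Integrable (fun z : Metric.sphere (0 : EuclideanSpace ℂ (Fin d)) 1 =>
        ((angle (b k) z.1 * angle (b l) z.1 : ℝ) : ℂ)) (sphereMeasure d) :=
      fun k l => integrable_of_continuous hd (by fun_prop)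
    have h1 : ∀ z : Metric.sphere (0 : EuclideanSpace ℂ (Fin d)) 1,
        ∑ k, ∑ l, ((angle (b k) z.1 * angle (b l) z.1 : ℝ) : ℂ) = 1 := by
      intro z
      have := sum_angle_basis b (z := z.1) (by simp)
      norm_cast
      rw [← Finset.sum_mul_sum, this, one_mul]
    simp_rw [← integral_finsetSum _ fun l _ => hint _ l]
    rw [← integral_finsetSum _ fun k _ => integrable_finsetSum _ fun l _ => hint k l]
    simp_rw [h1]
    simp
  simp only [hkl, Finset.sum_add_distrib, Finset.sum_ite_eq, Finset.mem_univ, if_true,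
    Finset.sum_const, Finset.card_univ, Fintype.card_fin, nsmul_eq_mul] at hone
  have hd0 : (d : ℂ) ≠ 0 := by exact_mod_cast hd
  have hd1 : (d : ℂ) + 1 ≠ 0 := by exact_mod_cast d.succ_ne_zero
  rw [eq_div_iff (mul_ne_zero hd0 hd1)]
  linear_combination 2 * hone

variable {B : Fin (d + 1) → OrthonormalBasis (Fin d) ℂ (EuclideanSpace ℂ (Fin d))}

/-- Parseval in one basis, applied to a vector of another, determines the constant. -/
lemma IsMutuallyUnbiased.angle_eq (hB : IsMutuallyUnbiased B) {i j : Fin (d + 1)}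
    (hij : i ≠ j) (k l : Fin d) : angle (B i k) (B j l) = 1 / d := by
  obtain ⟨α, hα⟩ := hB
  have h := sum_angle_basis (B i) (z := B j l) ((B j).orthonormal.1 l)
  simp only [hα i j hij, Finset.sum_const, Finset.card_univ, Fintype.card_fin, nsmul_eq_mul] at h
  rw [hα i j hij]
  exact eq_one_div_of_mul_eq_one_right h

lemma mem_basesUnion {x : EuclideanSpace ℂ (Fin d)} :
    x ∈ basesUnion B ↔ ∃ i k, B i k = x := by
  simp [basesUnion]

lemma norm_of_mem_basesUnion {x : EuclideanSpace ℂ (Fin d)} (hx : x ∈ basesUnion B) :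
    ‖x‖ = 1 := by
  obtain ⟨i, k, rfl⟩ := mem_basesUnion.1 hx
  exact (B i).orthonormal.1 k

lemma IsMutuallyUnbiased.injective (hd : 2 ≤ d) (hB : IsMutuallyUnbiased B) :
    Function.Injective fun p : Fin (d + 1) × Fin d => B p.1 p.2 := by
  rintro ⟨i, k⟩ ⟨j, l⟩ h
  simp only at h
  have h1 : angle (B i k) (B j l) = 1 := by rw [← h]; exact angle_self ((B i).orthonormal.1 k)
  by_cases hij : i = j
  · subst hij
    rw [angle_basis] at h1
    simp only [Prod.mk.injEq, true_and]
    by_contra hkl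
    simp [hkl] at h1
  · rw [hB.angle_eq hij, div_eq_one_iff_eq (by positivity)] at h1
    have : d = 1 := by exact_mod_cast h1.symm
    omega

lemma IsMutuallyUnbiased.degreeSet_eq (hd : 2 ≤ d) (hB : IsMutuallyUnbiased B) :
    degreeSet (basesUnion B : Set (EuclideanSpace ℂ (Fin d))) = {0, 1 / (d : ℝ)} := by
  have hinj := hB.injective hd
  ext α
  simp only [degreeSet, Finset.mem_coe, mem_basesUnion, Set.mem_ofPred_eq, Set.mem_insert_iff,
    Set.mem_singleton_iff]
  constructor
  · rintro ⟨_, ⟨i, k, rfl⟩, _, ⟨j, l, rfl⟩, hne, rfl⟩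
    by_cases hij : i = j
    · subst hij
      left
      rw [angle_basis, if_neg]
      rintro rfl
      exact hne rfl
    · exact Or.inr (hB.angle_eq hij k l)
  · have h01 : (⟨0, by omega⟩ : Fin d) ≠ ⟨1, by omega⟩ := by simp
    have h01' : (⟨0, by omega⟩ : Fin (d + 1)) ≠ ⟨1, by omega⟩ := by simp
    rintro (rfl | rfl)
    · refine ⟨_, ⟨0, ⟨0, by omega⟩, rfl⟩, _, ⟨0, ⟨1, by omega⟩, rfl⟩, fun h => ?_, ?_⟩
      · exact h01 ((B 0).orthonormal.linearIndependent.injective h)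
      · rw [angle_basis, if_neg h01]
    · refine ⟨_, ⟨_, ⟨0, by omega⟩, rfl⟩, _, ⟨_, ⟨0, by omega⟩, rfl⟩, fun h => ?_,
        hB.angle_eq h01' _ _⟩
      exact h01' (congrArg Prod.fst (@hinj (_, _) (_, _) h))

lemma IsMutuallyUnbiased.isDistanceSet (hd : 2 ≤ d) (hB : IsMutuallyUnbiased B) :
    IsDistanceSet (basesUnion B : Set (EuclideanSpace ℂ (Fin d))) 2 := by
  have hd' : (2 : ℝ) ≤ d := by exact_mod_cast hd
  refine ⟨fun x hx => norm_of_mem_basesUnion hx, ?_, ?_⟩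
  · rw [hB.degreeSet_eq hd]
    rintro (h | h)
    · exact one_ne_zero h
    · rw [Set.mem_singleton_iff, eq_comm, div_eq_one_iff_eq (by positivity)] at h
      linarith
  · rw [hB.degreeSet_eq hd, Set.encard_pair (by positivity)]
    rfl

lemma IsMutuallyUnbiased.card_basesUnion (hd : 2 ≤ d) (hB : IsMutuallyUnbiased B) :
    (basesUnion B).card = (d + 1) * d := by
  classical
  have := Finset.card_image_of_injective Finset.univ (hB.injective hd)
  simp only [Finset.card_univ, Fintype.card_prod, Fintype.card_fin] at this
  rw [← this, basesUnion]

lemma IsMutuallyUnbiased.sum_angle_sq (hd : 2 ≤ d) (hB : IsMutuallyUnbiased B)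
    {x : EuclideanSpace ℂ (Fin d)} (hx : x ∈ basesUnion B) :
    ∑ y ∈ basesUnion B, angle x y ^ 2 = 2 := by
  classical
  have hd0 : (d : ℝ) ≠ 0 := by positivity
  obtain ⟨i, k, rfl⟩ := mem_basesUnion.1 hx
  have himage : ∑ y ∈ basesUnion B, angle (B i k) y ^ 2 =
      ∑ p : Fin (d + 1) × Fin d, angle (B i k) (B p.1 p.2) ^ 2 := by
    rw [basesUnion, Finset.sum_image fun p _ q _ h => hB.injective hd h]
  -- The vector's own basis contributes `1` and each of the other `d` bases `d · (1/d)² = 1/d`, in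
  -- total `2`.
  have hj : ∀ j, ∑ l, angle (B i k) (B j l) ^ 2 =
      1 / (d : ℝ) + if i = j then 1 - 1 / (d : ℝ) else 0 := by
    intro j
    split_ifs with h
    · subst h
      simp [angle_basis]
    · simp only [hB.angle_eq h, Finset.sum_const, Finset.card_univ, Fintype.card_fin,
        nsmul_eq_mul]
      field_simp
      simp
  rw [himage, Fintype.sum_prod_type]
  simp only [hj, Finset.sum_add_distrib, Finset.sum_const, Finset.card_univ, Fintype.card_fin,
    nsmul_eq_mul, Finset.sum_ite_eq, Finset.mem_univ, if_true]
  push_cast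
  field_simp
  ring

/-- With `d(d+1)` vectors the average of the squared angles is `2 / (d(d+1))`, exactly the moment of
the sphere; this is where having `d + 1` bases matters. -/
theorem IsMutuallyUnbiased.isDesign (hd : 2 ≤ d) (hB : IsMutuallyUnbiased B) :
    IsDesign (basesUnion B) 2 := by
  refine isDesign_of_framePotential (by omega)
    ⟨_, mem_basesUnion.2 ⟨0, ⟨0, by omega⟩, rfl⟩⟩ (fun x hx => norm_of_mem_basesUnion hx)
    (fun x hx => integral_angle_sq (by omega) hx) fun x hx => ?_
  rw [← Complex.ofReal_sum, hB.sum_angle_sq hd hx, hB.card_basesUnion hd]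
  push_cast
  ring

end Unbiased

theorem mainTheorem10 :
    (∀ (d s : ℕ) (X : Finset (EuclideanSpace ℂ (Fin d))), 1 ≤ s →
      IsDistanceSet (X : Set (EuclideanSpace ℂ (Fin d))) s →
      IsDesign X (2 * (s - 1)) →
      AnglesFormQPolynomialScheme X s) ∧
    (∀ (d : ℕ) (X : Set (EuclideanSpace ℂ (Fin d))), IsDistanceSet X 1 →
      ∃ Y : Finset (EuclideanSpace ℂ (Fin d)), (Y : Set (EuclideanSpace ℂ (Fin d))) = X ∧
        IsDesign Y (2 * (1 - 1)) ∧ AnglesFormQPolynomialScheme Y 1) ∧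
    (∀ (d : ℕ) (B : Fin (d + 1) → OrthonormalBasis (Fin d) ℂ (EuclideanSpace ℂ (Fin d))), 2 ≤ d →
      IsMutuallyUnbiased B →
      IsDistanceSet (basesUnion B : Set (EuclideanSpace ℂ (Fin d))) 2 ∧
        IsDesign (basesUnion B) (2 * (2 - 1)) ∧
        AnglesFormQPolynomialScheme (basesUnion B) 2) := by
  refine ⟨fun d s X hs hX hdes => anglesFormQPolynomialScheme_of_design hs hX hdes,
    fun d X hX => equiangular_scheme hX, fun d B hd hB => ?_⟩
  have hdist := hB.isDistanceSet hd
  have hdes := hB.isDesign hd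
  exact ⟨hdist, hdes, anglesFormQPolynomialScheme_of_design (by omega) hdist hdes⟩
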